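/- Let $G(V,E,W)$ be a limited-flow network: $n$ nodes, $m\ge 1$ edges $e_1,\dots,e_m$ (each directed or undirected), maximal capacities $W(e)\in\mathbb{N}$, and two distinct nodes, the source and the sink. For $X\in\mathbb{N}^E$ with $X\le W$ let $W(X)$ be the value of a maximum flow from the source to the sink when the capacities are $X$, and write $X+0(e)$ for $X$ with the capacity of $e$ raised by one. For a demand $d\in\mathbb N$, $X$ is a $d$-MC if $W(X)=d$ and $W(X+0(e))>d$ for every edge $e$ with $X(e)<W(e)$. A minimal cut (MC) is an inclusion-minimal set of edges whose removal leaves no path from the source to the sink. Yeh's algorithm for enumerating the $d$-MCs takes the list $C_1,\dots,C_p$ of all MCs and treats, for each $C_i$, all integral solutions $X$ of $$\sum_{e\in C_i}X(e)=d,\qquad 0\le X(e)\le W(e)\ (e\in C_i),\qquad X(e)=W(e)\ (e\notin C_i),$$ one after the other, as follows. It computes a maximum flow for the capacities $X$ by the highest-label preflow-push algorithm (a max-flow algorithm of complexity $O(n^2\sqrt m)$). If its value is not $d$, $X$ is discarded. Otherwise, for $k=1,\dots,m$ with $X(e_k)<W(e_k)$, it searches the residual network of $X+0(e_k)$ with respect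 to that flow for a path from the source to the sink, by a graph search that scans adjacency lists; as soon as there is no such path, $X$ is discarded. If $X$ is never discarded, it is output as a $d$-MC. Running time is the number of elementary operations (unit-cost arithmetic on capacities, access to array entries, operations at the front of linked lists); the cost of producing the solutions $X$ by implicit enumeration is not counted. Let $\sigma\ge1$ be a bound for the number of solutions $X$ obtained from each MC. Then the time complexity of the algorithm is $O\big((m^2+n^2\sqrt m)\,p\,\sigma\big)$: there is an absolute constant $C$ such that, for every network with $m\ge1$, every $d$, every such $\sigma$, and every order in which the MCs and the solutions are listed, the algorithm halts after at most $C\,(m^2+n^2\sqrt m)\,p\,\sigma$ operations. It is not $O(mnp\sigma)$: for every constant $C$ there are a network with $m\ge1$, a demand $d\ge1$ and such a bound $\sigma\ge1$ for which the algorithm (with some order of listing) halts only after more than $C\,mnp\sigma$ operations. -/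

import Mathlib

namespace DMC

/-! ### Limited-flow networks -/

/-- A limited-flow (stochastic-flow) network with `n` nodes and `m` edges. The edge `e` joins
`fst e` to `snd e` and has the integral maximal capacity `W e`. It is an arc directed from `fst e`
to `snd e`, unless `undirected e` is `true`; then it can carry flow in either direction. Parallel
edges are allowed, and the underlying graph need not be connected. -/
structure Network (n m : ℕ) where
  fst : Fin m → Fin n
  snd : Fin m → Fin n
  undirected : Fin m → Bool
  W : Fin m → ℕ
  source : Fin n
  sink : Fin n
  source_ne_sink : source ≠ sink

/-- An edge together with a direction in which it is run through: `(e, true)` leads from `fst e`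
to `snd e`, and `(e, false)` leads back. -/
abbrev Arc (m : ℕ) : Type := Fin m × Bool

/-- A system-state vector: the current capacities of all edges. -/
abbrev StateVec (m : ℕ) : Type := Fin m → ℕ

/-- `X + 0(e)`: the capacity of `e` is raised by one. -/
def StateVec.raise {m : ℕ} (X : StateVec m) (e : Fin m) : StateVec m :=
  Function.update X e (X e + 1)

namespace Network

variable {n m : ℕ} (N : Network n m)

def tail (a : Arc m) : Fin n := if a.2 then N.fst a.1 else N.snd a.1

def head (a : Arc m) : Fin n := if a.2 then N.snd a.1 else N.fst a.1

/-- The adjacency list of a node: all arcs of residual networks that leave it. -/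
def adj (u : Fin n) : List (Arc m) :=
  ((List.finRange m).flatMap fun e => [(e, true), (e, false)]).filter fun a => N.tail a = u

/-- One can go from `u` to `v` along an edge outside `K`. -/
def Linked (K : Finset (Fin m)) (u v : Fin n) : Prop :=
  ∃ a : Arc m, a.1 ∉ K ∧ (a.2 = true ∨ N.undirected a.1 = true) ∧ N.tail a = u ∧ N.head a = v

/-- Removing the edges of `K` leaves no path from the source to the sink. -/
def IsCut (K : Finset (Fin m)) : Prop :=
  ¬ Relation.ReflTransGen (N.Linked K) N.source N.sink

/-- A minimal cut (MC): a cut none of whose proper subsets is a cut. -/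
def IsMinimalCut (K : Finset (Fin m)) : Prop :=
  Minimal N.IsCut K

/-- The system of equations and inequalities that belongs to the cut `K` and the demand `d`. -/
def IsFeasible (d : ℕ) (K : Finset (Fin m)) (X : StateVec m) : Prop :=
  ∑ e ∈ K, X e = d ∧ (∀ e ∈ K, X e ≤ N.W e) ∧ ∀ e ∉ K, X e = N.W e

/-- The residual capacity of an arc when the capacities are `X` and the flow `f` has been sent
(`f e` is negative when the flow runs from `snd e` to `fst e`). -/
def residual (X : StateVec m) (f : Fin m → ℤ) (a : Arc m) : ℤ :=
  if a.2 then X a.1 - f a.1 else f a.1 + (if N.undirected a.1 then (X a.1 : ℤ) else 0)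

end Network

/-! ### Running times

An algorithm is a transition function `step`; `step c = none` means that `c` is a halting
configuration. Every transition of the machines below performs a bounded number of elementary
operations (arithmetic on and comparison of numbers, reading or writing one array entry, operations
at the front of a linked list). Arrays are represented as functions. -/

/-- The run that starts in the given configuration halts after exactly `t` transitions. -/
inductive HaltsIn {α : Type*} (step : α → Option α) : α → ℕ → Prop
  | halt {c : α} : step c = none → HaltsIn step c 0
  | next {c c' : α} {t : ℕ} : step c = some c' → HaltsIn step c' t → HaltsIn step c (t + 1)

/-! ### Maximum flow: the highest-label preflow-push algorithm -/

/-- The stage of a run of the preflow-push algorithm. -/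
inductive PushStage (m : ℕ)
  /-- `k` array entries are still to be initialized -/
  | alloc (k : ℕ)
  /-- the listed arcs out of the source are still to be saturated -/
  | saturate (as : List (Arc m))
  | main
  | done

/-- The memory of the preflow-push algorithm: the preflow, the excesses, the distance labels, the
part of each adjacency list that begins with the current arc, the lists of the active nodes with
given label, and the index of the list that is being treated. -/
structure PushState (n m : ℕ) where
  stage : PushStage m
  flow : Fin m → ℤ
  excess : Fin n → ℤ
  label : Fin n → ℕ
  cur : Fin n → List (Arc m)
  bucket : ℕ → List (Fin n)
  level : ℕ

namespace PushState

variable {n m : ℕ} (N : Network n m) (X : StateVec m)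

/-- The beginning of a run: `m` flow values, `n` excesses, `n` labels, `n` current arcs and `2 n`
lists of nodes are to be initialized. -/
def start : PushState n m where
  stage := .alloc (m + 5 * n)
  flow := fun _ => 0
  excess := fun _ => 0
  label := fun v => if v = N.source then n else 0
  cur := N.adj
  bucket := fun _ => []
  level := 0

/-- Send `δ` units along the arc `a`. If its head becomes active, it enters its list. -/
def push (s : PushState n m) (a : Arc m) (δ : ℤ) : PushState n m :=
  let u := N.tail a
  let v := N.head a
  let ex := Function.update s.excess u (s.excess u - δ)
  { s with
    flow := Function.update s.flow a.1 (if a.2 then s.flow a.1 + δ else s.flow a.1 - δ)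
    excess := Function.update ex v (ex v + δ)
    bucket :=
      if s.excess v = 0 ∧ 0 < δ ∧ v ≠ N.source ∧ v ≠ N.sink then
        Function.update s.bucket (s.label v) (v :: s.bucket (s.label v))
      else s.bucket }

/-- Raise the label of the node `u`, which is the first one of the list that is being treated and
is followed there by `us`; the scan of its adjacency list begins anew. -/
def relabel (s : PushState n m) (u : Fin n) (us : List (Fin n)) : PushState n m :=
  { s with
    label := Function.update s.label u (s.label u + 1)
    cur := Function.update s.cur u (N.adj u)
    bucket := Function.update (Function.update s.bucket s.level us)
      (s.level + 1) (u :: s.bucket (s.level + 1))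
    level := s.level + 1 }

/-- One transition of the main loop: treat the first node of the highest nonempty list. -/
def mainStep (s : PushState n m) : PushState n m :=
  match s.bucket s.level with
  | [] =>
      if s.level = 0 then { s with stage := .done } else { s with level := s.level - 1 }
  | u :: us =>
      if s.excess u = 0 then
        { s with bucket := Function.update s.bucket s.level us }
      else
        match s.cur u with
        | [] => s.relabel N u us
        | a :: as =>
            if 0 < N.residual X s.flow a ∧ s.label u = s.label (N.head a) + 1 then
              s.push N a (min (s.excess u) (N.residual X s.flow a))
            else
              { s with cur := Function.update s.cur u as }

/-- The transition function of the preflow-push algorithm for the capacities `X`. -/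
def step (s : PushState n m) : Option (PushState n m) :=
  match s.stage with
  | .alloc 0 => some { s with stage := .saturate (N.adj N.source) }
  | .alloc (k + 1) => some { s with stage := .alloc k }
  | .saturate [] => some { s with stage := .main }
  | .saturate (a :: as) =>
      some { s.push N a (N.residual X s.flow a) with stage := .saturate as }
  | .main => some (s.mainStep N X)
  | .done => none

end PushState

/-! ### Path search in a residual network -/

/-- The memory of the graph search: the number of array entries still to be initialized, the marks,
the nodes that are marked but not yet scanned, and the arcs still to be examined at the node that
is being scanned. -/
structure SearchState (n m : ℕ) where
  alloc : ℕ
  marked : Fin n → Bool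
  pending : List (Fin n)
  arcs : List (Arc m)
  found : Bool

namespace SearchState

variable {n m : ℕ} (N : Network n m) (X : StateVec m) (f : Fin m → ℤ)

def start : SearchState n m where
  alloc := n
  marked := fun v => v = N.source
  pending := [N.source]
  arcs := []
  found := false

/-- The transition function of the search for a path from the source to the sink in the residual
network for the capacities `X` and the flow `f`. It stops when the sink is taken up (`found`) or
when no node is left. -/
def step (s : SearchState n m) : Option (SearchState n m) :=
  match s.alloc with
  | k + 1 => some { s with alloc := k }
  | 0 =>
      match s.found, s.arcs, s.pending with
      | true, _, _ => none
      | false, a :: as, us =>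
          if 0 < N.residual X f a ∧ s.marked (N.head a) = false then
            some { s with
              marked := Function.update s.marked (N.head a) true
              pending := N.head a :: us
              arcs := as }
          else some { s with arcs := as }
      | false, [], u :: us =>
          if u = N.sink then some { s with found := true }
          else some { s with pending := us, arcs := N.adj u }
      | false, [], [] => none

end SearchState

/-! ### Yeh's algorithm -/

/-- What the algorithm keeps from one candidate to the next: the minimal cuts after the current
one, the feasible solutions of the current one that have not yet been treated, and the `d`-MCs
found so far. -/
structure Memory (m : ℕ) where
  cuts : List (Finset (Fin m))
  sols : List (StateVec m)
  output : List (StateVec m)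

/-- The configurations of the algorithm, by the step that comes next. In steps 5 to 7, `e` is the
edge under consideration and `es` are the edges after it. -/
inductive Config (n m : ℕ)
  | step1
  | step2 (M : Memory m)
  | step3 (M : Memory m) (X : StateVec m) (s : PushState n m)
  | step4 (M : Memory m) (X : StateVec m) (f : Fin m → ℤ) (value : ℤ)
  | step5 (M : Memory m) (X : StateVec m) (f : Fin m → ℤ) (e : Fin m) (es : List (Fin m))
  | step6 (M : Memory m) (X : StateVec m) (f : Fin m → ℤ) (e : Fin m) (es : List (Fin m))
      (s : SearchState n m)
  | step7 (M : Memory m) (X : StateVec m) (f : Fin m → ℤ) (es : List (Fin m))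
  | step8 (M : Memory m)
  | halted (output : List (StateVec m))

variable {n m : ℕ}

/-- The transition function of Yeh's algorithm for the network `N`, the demand `d` and the list
`cuts` of the minimal cuts. The implicit enumeration is represented by the list `enum K` of the
feasible solutions for the cut `K`; what it costs to produce the solutions is not counted, but every
request for the next one is. -/
def yehStep (N : Network n m) (d : ℕ) (cuts : List (Finset (Fin m)))
    (enum : Finset (Fin m) → List (StateVec m)) : Config n m → Option (Config n m)
  -- step 1: begin with the first minimal cut
  | .step1 =>
      match cuts with
      | [] => some (.halted [])
      | K :: Ks => some (.step2 ⟨Ks, enum K, []⟩)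
  -- step 2: the next feasible solution `X`, if there is one
  | .step2 M =>
      match M.sols with
      | [] => some (.step8 M)
      | X :: Xs => some (.step3 { M with sols := Xs } X (PushState.start N))
  -- step 3: a maximum flow for the capacities `X`
  | .step3 M X s =>
      match s.step N X with
      | some s' => some (.step3 M X s')
      | none => some (.step4 M X s.flow (s.excess N.sink))
  -- step 4: is the maximum flow value `d`?
  | .step4 M X f value =>
      if value = d then
        match List.finRange m with
        | e :: es => some (.step5 M X f e es)
        | [] => some (.step7 M X f [])
      else some (.step2 M)
  -- step 5: edges at their maximal capacity are passed over
  | .step5 M X f e es =>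
      if X e = N.W e then some (.step7 M X f es)
      else some (.step6 M X f e es (SearchState.start N))
  -- step 6: a path in the residual network of `X + 0(e)` after `d` units have been sent
  | .step6 M X f e es s =>
      match s.step N (X.raise e) f with
      | some s' => some (.step6 M X f e es s')
      | none => if s.found then some (.step7 M X f es) else some (.step2 M)
  -- step 7: the next edge; if there is none, `X` is a `d`-MC
  | .step7 M X f es =>
      match es with
      | e :: es' => some (.step5 M X f e es')
      | [] => some (.step2 { M with output := X :: M.output })
  -- step 8: the next minimal cut; if there is none, halt
  | .step8 M =>
      match M.cuts with
      | K :: Ks => some (.step2 ⟨Ks, enum K, M.output⟩)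
      | [] => some (.halted M.output)
  | .halted _ => none

/-- `cuts` lists all minimal cuts of `N`, and `enum` lists, for each of them, all solutions of its
system for the demand `d`, in any order and without repetition. -/
structure IsInput (N : Network n m) (d : ℕ) (cuts : List (Finset (Fin m)))
    (enum : Finset (Fin m) → List (StateVec m)) : Prop where
  cuts_nodup : cuts.Nodup
  mem_cuts : ∀ K, K ∈ cuts ↔ N.IsMinimalCut K
  enum_nodup : ∀ K ∈ cuts, (enum K).Nodup
  mem_enum : ∀ K ∈ cuts, ∀ X, X ∈ enum K ↔ N.IsFeasible d K X

end DMC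

/-!
The upper bound rests on an amortized analysis of the highest-label preflow-push algorithm
(Cheriyan and Maheshwari, in the form given by Cheriyan and Mehlhorn). Labels stay below `2 n`
(`Network.IsPreflow.label_lt`), since a node with excess can always send it back to the source.
Hence there are `O(n r)` relabellings, where `r ≤ min n (2 m)` is the number of non-isolated nodes,
and `O(n m)` saturating pushes and advances of current arcs. For the pushes that empty a node, give
each active node the rank "number of non-isolated nodes with at most its label". Such a push from
the highest level `ℓ` replaces an active node by one of the next lower level, and lowers the total
rank by the number of nodes on level `ℓ`. If this is at least `K`, the total rank pays for the push;
it rises by at most `r` with a relabelling or a saturating push. If it is less than `K`, then the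
level has fewer than `K` active nodes, and the push lowers their number, so that at most `K` such
pushes occur before the level changes, which happens `O(n r)` times. Instead of splitting a run into
phases, all this is put into one function of the state, `PushState.potential`, which drops by at
least `K` with every transition; with `K` of the order of `√m` this gives
`O(n m + n² √m)` (`PushState.haltsWithin_start`). Using `r ≤ 2 m` besides `r ≤ n` makes the bound
hold also where there are fewer edges than nodes. Each candidate moreover causes at most `m` graph
searches of cost `O(n + m)`, and `n m ≤ m² + n²`. A network has at least one minimal cut, so the
constant cost of starting and halting is absorbed as well.

For the lower bound, each of the up to `m` searches for one candidate may have to examine `m` arcs,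
which costs `m²` however few nodes there are. This happens in the network of `m` parallel arcs of
capacity one for the demand `1`: it has one minimal cut, the `m` candidates are the unit vectors,
all of them are `1`-MCs, and for each of them `m - 1` searches succeed, each after a scan of the
whole adjacency list of the source (`takesAtLeast_parallelNet`). This is more than `C m n p σ` as
soon as `m` exceeds `n = 2` by a large factor.
-/

namespace DMC

/-! ### Running times -/

/-- The run that starts in the given configuration halts after at most `b` transitions. -/
def HaltsWithin {α : Type*} (step : α → Option α) (c : α) (b : ℕ) : Prop :=
  ∃ t ≤ b, HaltsIn step c t

section HaltsWithin

variable {α : Type*} {step : α → Option α} {c c' : α} {b b' : ℕ}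

theorem HaltsWithin.mono (h : HaltsWithin step c b) (hb : b ≤ b') : HaltsWithin step c b' :=
  let ⟨t, ht, h⟩ := h
  ⟨t, ht.trans hb, h⟩

theorem HaltsWithin.of_halt (h : step c = none) : HaltsWithin step c b :=
  ⟨0, Nat.zero_le _, .halt h⟩

theorem HaltsWithin.next (h' : HaltsWithin step c' b) (h : step c = some c') :
    HaltsWithin step c (b + 1) :=
  let ⟨t, ht, h'⟩ := h'
  ⟨t + 1, Nat.succ_le_succ ht, .next h h'⟩

/-- A potential that every transition lowers bounds the running time. -/
theorem HaltsWithin.of_potential (pot : α → ℕ)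
    (hpot : ∀ c c', step c = some c' → pot c' < pot c) (c : α) : HaltsWithin step c (pot c) := by
  induction h : pot c using Nat.strong_induction_on generalizing c with
  | _ k ih =>
    cases hs : step c with
    | none => exact .of_halt hs
    | some c' =>
      have hlt := hpot c c' hs
      exact ((ih (pot c') (h ▸ hlt) c' rfl).next hs).mono (by omega)

end HaltsWithin

namespace Network

variable {n m : ℕ} (N : Network n m)

theorem mem_adj {u : Fin n} {a : Arc m} : a ∈ N.adj u ↔ N.tail a = u := by
  obtain ⟨e, b⟩ := a
  cases b <;> simp [adj]

/-- Every arc is in exactly one adjacency list. -/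
theorem sum_length_adj : ∑ u, (N.adj u).length = 2 * m := by
  have key : ∀ l : List (Arc m),
      ∑ u, (l.filter fun a => N.tail a = u).length = l.length := by
    intro l
    induction l with
    | nil => simp
    | cons a l ih =>
      have : ∀ u, ((a :: l).filter fun a => N.tail a = u).length =
          (if N.tail a = u then 1 else 0) + (l.filter fun a => N.tail a = u).length := by
        intro u
        by_cases h : N.tail a = u <;> simp [h, add_comm]
      simp only [this, Finset.sum_add_distrib, ih]
      simp [add_comm]
  unfold adj
  rw [key]
  simp [List.length_flatMap, mul_comm]

theorem two_le_nodes (N : Network n m) : 2 ≤ n := by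
  have h := N.source_ne_sink
  have h1 := N.source.isLt
  have h2 := N.sink.isLt
  by_contra hn
  exact h (Fin.ext (by omega))

end Network

namespace SearchState

variable {n m : ℕ} (N : Network n m)

/-- The arcs still to be examined, those of the pending nodes included, and a charge for every node
that is not yet marked. -/
def potential (s : SearchState n m) : ℕ :=
  s.alloc + s.arcs.length + (s.pending.map fun u => (N.adj u).length + 1).sum +
    (∑ u, if s.marked u then 0 else (N.adj u).length + 2) + (if s.found then 0 else 1)

theorem potential_step {X : StateVec m} {f : Fin m → ℤ} {s s' : SearchState n m}
    (h : s.step N X f = some s') : s'.potential N < s.potential N := by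
  obtain ⟨k, mk, pd, as, fd⟩ := s
  rcases k with _ | k
  · rcases fd with _ | _
    · rcases as with _ | ⟨a, as⟩
      · rcases pd with _ | ⟨u, us⟩
        · simp [step] at h
        · simp only [step] at h
          split_ifs at h with hu
          · cases h
            simp [potential]
          · cases h
            simp only [potential, List.map_cons, List.sum_cons, List.length_nil]
            omega
      · simp only [step] at h
        split_ifs at h with ha
        · cases h
          have hsum : (∑ u, if mk u then 0 else (N.adj u).length + 2) =
              (∑ u, if Function.update mk (N.head a) true u then 0 else (N.adj u).length + 2) +
                ((N.adj (N.head a)).length + 2) := by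
            rw [← Finset.add_sum_erase _ _ (Finset.mem_univ (N.head a)),
              ← Finset.add_sum_erase _ (fun u => if Function.update mk (N.head a) true u then 0
                else (N.adj u).length + 2) (Finset.mem_univ (N.head a))]
            have : ∀ u ∈ Finset.univ.erase (N.head a),
                (if Function.update mk (N.head a) true u then 0 else (N.adj u).length + 2) =
                  (if mk u then 0 else (N.adj u).length + 2) := by
              intro u hu
              rw [Function.update_of_ne (Finset.ne_of_mem_erase hu)]
            rw [Finset.sum_congr rfl this]
            have h2 := ha.2
            simp [h2, add_comm]
          simp only [potential, List.map_cons, List.sum_cons, List.length_cons]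
          rw [hsum]
          omega
        · cases h
          simp only [potential, List.length_cons]
          omega
    · simp [step] at h
  · simp only [step] at h
    cases h
    simp only [potential]
    omega

/-- The graph search takes time `O(n + m)`. -/
theorem haltsWithin_start (X : StateVec m) (f : Fin m → ℤ) :
    HaltsWithin (step N X f) (start N) (3 * n + 2 * m + 1) := by
  refine (HaltsWithin.of_potential (potential N) (fun _ _ => potential_step N) _).mono ?_
  have h1 : (∑ u, if (start N).marked u then 0 else (N.adj u).length + 2) +
      ((N.adj N.source).length + 2) = 2 * m + 2 * n := by
    have h2 : ∑ u, ((N.adj u).length + 2) = 2 * m + 2 * n := by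
      rw [Finset.sum_add_distrib, N.sum_length_adj]
      simp [mul_comm]
    rw [← h2, ← Finset.add_sum_erase _ _ (Finset.mem_univ N.source),
      ← Finset.add_sum_erase _ (fun u => (N.adj u).length + 2) (Finset.mem_univ N.source),
      Finset.sum_congr rfl (g := fun u => (N.adj u).length + 2)]
    · simp [start, add_comm]
    · intro u hu
      simp [start, Finset.ne_of_mem_erase hu]
  have h3 : potential N (start N) = n + 0 + ((N.adj N.source).length + 1 + 0) +
      (∑ u, if (start N).marked u then 0 else (N.adj u).length + 2) + 1 := rfl
  omega

end SearchState

/-! ### Preflows and labels -/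

namespace Network

variable {n m : ℕ} (N : Network n m)

/-- The arc that runs through the same edge in the opposite direction. -/
def rev (a : Arc m) : Arc m := (a.1, !a.2)

@[simp] theorem tail_rev (a : Arc m) : N.tail (rev a) = N.head a := by
  obtain ⟨e, b⟩ := a
  cases b <;> rfl

@[simp] theorem head_rev (a : Arc m) : N.head (rev a) = N.tail a := by
  obtain ⟨e, b⟩ := a
  cases b <;> rfl

/-- What flows into the node `w` minus what flows out of it. -/
def netIn (f : Fin m → ℤ) (w : Fin n) : ℤ :=
  ∑ e, ((if N.snd e = w then f e else 0) - (if N.fst e = w then f e else 0))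

/-- The pair of a flow and an excess function is a preflow for the capacities `X`. -/
structure IsPreflow (X : StateVec m) (f : Fin m → ℤ) (ex : Fin n → ℤ) : Prop where
  excess_eq : ∀ w, ex w = N.netIn f w
  excess_nonneg : ∀ w, w ≠ N.source → 0 ≤ ex w
  residual_nonneg : ∀ a, 0 ≤ N.residual X f a

/-- The labels are a valid distance labelling: they drop by at most one along residual arcs. -/
structure IsLabelling (X : StateVec m) (f : Fin m → ℤ) (label : Fin n → ℕ) : Prop where
  source : label N.source = n
  sink : label N.sink = 0
  valid : ∀ a, 0 < N.residual X f a → label (N.tail a) ≤ label (N.head a) + 1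

variable {N} {X : StateVec m} {f : Fin m → ℤ} {ex : Fin n → ℤ} {label : Fin n → ℕ}

/-- If no residual arc leaves the set `S`, the total excess in `S` is not positive. -/
theorem IsPreflow.sum_excess_nonpos (h : N.IsPreflow X f ex) (S : Finset (Fin n))
    (hS : ∀ a, N.tail a ∈ S → N.head a ∉ S → N.residual X f a ≤ 0) : ∑ w ∈ S, ex w ≤ 0 := by
  simp only [h.excess_eq, netIn]
  rw [Finset.sum_comm]
  refine Finset.sum_nonpos fun e _ => ?_
  rw [Finset.sum_sub_distrib, Finset.sum_ite_eq, Finset.sum_ite_eq]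
  have h1 := hS (e, true)
  have h2 := hS (e, false)
  simp only [tail, head, residual, if_true, Bool.false_eq_true, if_false] at h1 h2
  by_cases hs : N.snd e ∈ S <;> by_cases ht : N.fst e ∈ S <;>
    simp only [hs, ht, if_true, if_false, not_true, not_false_iff, forall_true_left] at h1 h2 ⊢
  · simp
  · have : (0 : ℤ) ≤ if N.undirected e = true then (X e : ℤ) else 0 := by split_ifs <;> simp
    linarith
  · have : (0 : ℤ) ≤ (X e : ℤ) := by positivity
    linarith
  · simp

/-- A node with positive excess can be reached back from the source, so its label is less than
`2 n`. Paths are avoided: a larger label would leave some value `k` between `n` and `2 n`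
unattained, and no residual arc could leave the set of the nodes with label above `k`. -/
theorem IsPreflow.label_lt (h : N.IsPreflow X f ex) (hl : N.IsLabelling X f label) {v : Fin n}
    (hv : 0 < ex v) (hvs : v ≠ N.source) : label v < 2 * n := by
  by_contra hlt
  rw [not_lt] at hlt
  obtain ⟨k, hk, hk'⟩ : ∃ k ∈ Finset.Ioo n (2 * n),
      k ∉ ((Finset.univ.erase v).erase N.source).image label := by
    apply Finset.exists_mem_notMem_of_card_lt_card
    refine Finset.card_image_le.trans_lt ?_
    rw [Finset.card_erase_of_mem (by simp [hvs.symm]), Finset.card_erase_of_mem (by simp)]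
    have := N.two_le_nodes
    simp
    omega
  rw [Finset.mem_Ioo] at hk
  have hne : ∀ w, label w ≠ k := by
    intro w hw
    by_cases h1 : w = v
    · subst h1; omega
    by_cases h2 : w = N.source
    · subst h2; rw [hl.source] at hw; omega
    exact hk' (Finset.mem_image.2 ⟨w, by simp [h1, h2], hw⟩)
  have hsum := h.sum_excess_nonpos (Finset.univ.filter fun w => k < label w) (by
    intro a ha hb
    by_contra hpos
    have := hl.valid a (not_le.1 hpos)
    have h1 := hne (N.head a)
    simp only [Finset.mem_filter, Finset.mem_univ, true_and] at ha hb
    omega)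
  have hpos : 0 < ∑ w ∈ Finset.univ.filter (fun w => k < label w), ex w := by
    refine Finset.sum_pos' (fun w hw => h.excess_nonneg w ?_) ⟨v, ?_, hv⟩
    · rintro rfl
      simp only [Finset.mem_filter, Finset.mem_univ, true_and, hl.source] at hw
      omega
    · simp only [Finset.mem_filter, Finset.mem_univ, true_and]
      omega
  exact absurd hsum (not_le.2 hpos)

/-- Nodes without arcs never have an excess. -/
theorem IsPreflow.adj_ne_nil (h : N.IsPreflow X f ex) {v : Fin n} (hv : ex v ≠ 0) :
    N.adj v ≠ [] := by
  intro hadj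
  have hno : ∀ a, N.tail a ≠ v := fun a ha => by
    have := N.mem_adj.2 ha
    simp [hadj] at this
  refine hv ?_
  rw [h.excess_eq, netIn]
  refine Finset.sum_eq_zero fun e _ => ?_
  have h1 : N.fst e ≠ v := hno (e, true)
  have h2 : N.snd e ≠ v := hno (e, false)
  simp [h1, h2]

end Network

namespace PushState

open Network

variable {n m : ℕ} {N : Network n m} {X : StateVec m} {s : PushState n m}

theorem push_excess (a : Arc m) (δ : ℤ) (w : Fin n) : (s.push N a δ).excess w =
    s.excess w - (if w = N.tail a then δ else 0) + (if w = N.head a then δ else 0) := by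
  simp only [push, Function.update_apply]
  split_ifs <;> simp_all

theorem push_residual (a : Arc m) (δ : ℤ) (b : Arc m) : N.residual X (s.push N a δ).flow b =
    N.residual X s.flow b - (if b = a then δ else 0) + (if b = rev a then δ else 0) := by
  obtain ⟨e, b⟩ := b
  obtain ⟨e', b'⟩ := a
  by_cases h : e = e'
  · subst h
    cases b <;> cases b' <;> simp [push, Network.residual, rev] <;> ring
  · simp [push, Network.residual, rev, h]

theorem push_netIn (a : Arc m) (δ : ℤ) (w : Fin n) : N.netIn (s.push N a δ).flow w =
    N.netIn s.flow w - (if w = N.tail a then δ else 0) + (if w = N.head a then δ else 0) := by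
  obtain ⟨e, b⟩ := a
  have key : ∀ e', ((if N.snd e' = w then (s.push N (e, b) δ).flow e' else 0) -
      (if N.fst e' = w then (s.push N (e, b) δ).flow e' else 0)) =
      ((if N.snd e' = w then s.flow e' else 0) - (if N.fst e' = w then s.flow e' else 0)) +
      (if e' = e then (if w = N.head (e, b) then δ else 0) -
        (if w = N.tail (e, b) then δ else 0) else 0) := by
    intro e'
    by_cases h : e' = e
    · subst h
      cases b <;> simp only [push, head, tail, Function.update_self, if_true,
        Bool.false_eq_true, if_false, eq_comm (a := w)] <;> split_ifs <;> ring
    · simp [push, h]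
  simp only [netIn]
  rw [Finset.sum_congr rfl fun e' _ => key e', Finset.sum_add_distrib]
  simp
  ring

theorem isPreflow_push (h : N.IsPreflow X s.flow s.excess) {a : Arc m} {δ : ℤ} (hδ : 0 ≤ δ)
    (hδr : δ ≤ N.residual X s.flow a) (hδe : N.tail a = N.source ∨ δ ≤ s.excess (N.tail a)) :
    N.IsPreflow X (s.push N a δ).flow (s.push N a δ).excess where
  excess_eq w := by rw [push_excess, push_netIn, h.excess_eq]
  excess_nonneg w hw := by
    rw [push_excess]
    have := h.excess_nonneg w hw
    rcases eq_or_ne w (N.tail a) with rfl | h1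
    · have := hδe.resolve_left hw
      split_ifs <;> linarith
    · rw [if_neg h1]
      split_ifs <;> linarith
  residual_nonneg b := by
    rw [push_residual]
    have := h.residual_nonneg b
    rcases eq_or_ne b a with rfl | h1
    · split_ifs <;> linarith
    · rw [if_neg h1]
      split_ifs <;> linarith

variable (N X) in
/-- No flow can be pushed along the arc `a`. -/
def Inadmissible (s : PushState n m) (a : Arc m) : Prop :=
  N.residual X s.flow a ≤ 0 ∨ s.label (N.tail a) ≤ s.label (N.head a)

variable (N) in
/-- The node `v` can and must still pass on flow. -/
def Active (s : PushState n m) (v : Fin n) : Prop :=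
  0 < s.excess v ∧ v ≠ N.source ∧ v ≠ N.sink

variable (N X) in
/-- The invariants of the main loop. A listed node without excess is the one that is being treated:
it has just been emptied by a push. -/
structure Inv (s : PushState n m) : Prop where
  preflow : N.IsPreflow X s.flow s.excess
  labelling : N.IsLabelling X s.flow s.label
  label_lt : ∀ v, s.label v < 2 * n
  tail_cur : ∀ u, ∀ a ∈ s.cur u, N.tail a = u
  inadmissible : ∀ a, a ∉ s.cur (N.tail a) → s.Inadmissible N X a
  bucket : ∀ k, ∀ v ∈ s.bucket k, s.label v = k ∧ v ≠ N.source ∧ v ≠ N.sink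
  bucket_nodup : ∀ k, (s.bucket k).Nodup
  mem_bucket : ∀ v, s.Active N v → v ∈ s.bucket (s.label v)
  eq_head : ∀ k, ∀ v ∈ s.bucket k, s.excess v = 0 → k = s.level ∧ (s.bucket s.level).head? = some v
  bucket_above : ∀ k, s.level < k → s.bucket k = []

theorem Inv.admissible_iff (h : s.Inv N X) (a : Arc m) :
    (0 < N.residual X s.flow a ∧ s.label (N.tail a) = s.label (N.head a) + 1) ↔
      ¬ s.Inadmissible N X a := by
  have := h.labelling.valid a
  unfold Inadmissible
  constructor
  · rintro ⟨h1, h2⟩ (h3 | h3)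
    · exact absurd h1 (not_lt.2 h3)
    · omega
  · intro h3
    push Not at h3
    exact ⟨h3.1, by have := this h3.1; omega⟩

/-- A push along an admissible arc does not make other arcs admissible: residual capacity is gained
only by the opposite arc, which leads upwards. -/
theorem Inadmissible.push {a b : Arc m} {δ : ℤ} (hδ : 0 ≤ δ)
    (ha : s.label (N.head a) ≤ s.label (N.tail a))
    (hb : s.Inadmissible N X b) : (s.push N a δ).Inadmissible N X b := by
  rcases hb with hb | hb
  · by_cases hba : b = rev a
    · subst hba
      exact .inr (by simpa [PushState.push] using ha)
    · refine .inl ?_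
      rw [push_residual, if_neg hba]
      split_ifs <;> linarith
  · exact .inr hb

/-! ### The transitions of the main loop -/

/-- The node treated next is dropped if it has no excess. -/
theorem Inv.pop (h : s.Inv N X) {u : Fin n} {us : List (Fin n)} (hb : s.bucket s.level = u :: us)
    (hu : s.excess u = 0) :
    Inv N X { s with bucket := Function.update s.bucket s.level us } where
  preflow := h.preflow
  labelling := h.labelling
  label_lt := h.label_lt
  tail_cur := h.tail_cur
  inadmissible := h.inadmissible
  bucket k v hv := by
    refine h.bucket k v ?_
    by_cases hk : k = s.level
    · subst hk
      simp only [Function.update_self] at hv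
      rw [hb]
      exact List.mem_cons_of_mem _ hv
    · simpa [hk] using hv
  bucket_nodup k := by
    by_cases hk : k = s.level
    · subst hk
      have := h.bucket_nodup s.level
      rw [hb] at this
      simpa using this.of_cons
    · simpa [hk] using h.bucket_nodup k
  mem_bucket v hv := by
    have h1 := h.mem_bucket v hv
    by_cases hk : s.label v = s.level
    · rw [hk, hb] at h1
      simp only [hk, Function.update_self]
      refine (List.mem_cons.1 h1).resolve_left ?_
      rintro rfl
      exact absurd hu hv.1.ne'
    · simpa [hk] using h1
  eq_head k v hv hv0 := by
    exfalso
    have hnd := h.bucket_nodup s.level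
    rw [hb, List.nodup_cons] at hnd
    by_cases hk : k = s.level
    · subst hk
      simp only [Function.update_self] at hv
      have := (h.eq_head s.level v (by rw [hb]; exact List.mem_cons_of_mem _ hv) hv0).2
      rw [hb, List.head?_cons, Option.some_inj] at this
      exact hnd.1 (this ▸ hv)
    · simp only [Function.update_of_ne hk] at hv
      exact hk (h.eq_head k v hv hv0).1
  bucket_above k hk := by
    have : k ≠ s.level := by rintro rfl; exact lt_irrefl _ hk
    simpa [this] using h.bucket_above k hk

/-- The level falls when its list is empty. -/
theorem Inv.lower (h : s.Inv N X) (hb : s.bucket s.level = []) :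
    Inv N X { s with level := s.level - 1 } where
  preflow := h.preflow
  labelling := h.labelling
  label_lt := h.label_lt
  tail_cur := h.tail_cur
  inadmissible := h.inadmissible
  bucket := h.bucket
  bucket_nodup := h.bucket_nodup
  mem_bucket := h.mem_bucket
  eq_head k v hv hv0 := by
    have := (h.eq_head k v hv hv0).2
    simp [hb] at this
  bucket_above k hk := by
    simp only at hk ⊢
    rcases eq_or_ne k s.level with rfl | h1
    · exact hb
    · exact h.bucket_above k (by omega)

/-- An inadmissible current arc is passed over. -/
theorem Inv.scan (h : s.Inv N X) {u : Fin n} {a : Arc m} {as : List (Arc m)}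
    (hc : s.cur u = a :: as) (ha : s.Inadmissible N X a) :
    Inv N X { s with cur := Function.update s.cur u as } where
  preflow := h.preflow
  labelling := h.labelling
  label_lt := h.label_lt
  tail_cur w b hb := by
    by_cases hw : w = u
    · subst hw
      simp only [Function.update_self] at hb
      exact h.tail_cur w b (by rw [hc]; exact List.mem_cons_of_mem _ hb)
    · exact h.tail_cur w b (by simpa [hw] using hb)
  inadmissible b hb := by
    by_cases hw : N.tail b = u
    · rcases eq_or_ne b a with rfl | hba
      · exact ha
      · refine h.inadmissible b ?_
        simp only [hw, Function.update_self] at hb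
        rw [hw, hc, List.mem_cons]
        exact not_or.2 ⟨hba, hb⟩
    · exact h.inadmissible b (by simpa [hw] using hb)
  bucket := h.bucket
  bucket_nodup := h.bucket_nodup
  mem_bucket := h.mem_bucket
  eq_head := h.eq_head
  bucket_above := h.bucket_above

/-- When the adjacency list of the node is exhausted, all arcs that leave it are inadmissible, and
its label can be raised. -/
theorem Inv.relabel (h : s.Inv N X) {u : Fin n} {us : List (Fin n)}
    (hb : s.bucket s.level = u :: us) (hu : s.excess u ≠ 0) (hc : s.cur u = []) :
    Inv N X (s.relabel N u us) := by
  have hmem : u ∈ s.bucket s.level := by rw [hb]; exact List.mem_cons_self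
  obtain ⟨hlu, hus, hut⟩ := h.bucket _ u hmem
  have hnd := h.bucket_nodup s.level
  rw [hb, List.nodup_cons] at hnd
  have hlab : N.IsLabelling X s.flow (Function.update s.label u (s.label u + 1)) := by
    refine ⟨?_, ?_, fun a ha => ?_⟩
    · rw [Function.update_of_ne hus.symm, h.labelling.source]
    · rw [Function.update_of_ne hut.symm, h.labelling.sink]
    · have hv := h.labelling.valid a ha
      by_cases h1 : N.tail a = u
      · have h2 := h.inadmissible a (by rw [h1, hc]; simp)
        have h3 := h2.resolve_left (not_le.2 ha)
        rw [h1] at h3 ⊢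
        rw [Function.update_self, Function.update_apply]
        split_ifs with h4
        · omega
        · omega
      · rw [Function.update_of_ne h1, Function.update_apply]
        split_ifs with h4
        · rw [h4] at hv; omega
        · exact hv
  have hupos : 0 < s.excess u := lt_of_le_of_ne (h.preflow.excess_nonneg u hus) hu.symm
  have habove : s.bucket (s.level + 1) = [] := h.bucket_above _ (Nat.lt_succ_self _)
  have hbk : ∀ k, (s.relabel N u us).bucket k =
      if k = s.level + 1 then [u] else if k = s.level then us else s.bucket k := by
    intro k
    simp only [PushState.relabel, Function.update_apply, habove]
  have hmem' : ∀ k v, v ∈ (s.relabel N u us).bucket k →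
      (k = s.level + 1 ∧ v = u) ∨ (v ∈ s.bucket k ∧ v ≠ u) := by
    intro k v hv
    rw [hbk] at hv
    split_ifs at hv with h1 h2
    · exact .inl ⟨h1, by simpa using hv⟩
    · subst h2
      exact .inr ⟨by rw [hb]; exact List.mem_cons_of_mem _ hv, fun h3 => hnd.1 (h3 ▸ hv)⟩
    · refine .inr ⟨hv, ?_⟩
      rintro rfl
      exact h2 ((h.bucket k v hv).1 ▸ hlu)
  refine ⟨h.preflow, hlab, ?_, ?_, ?_, ?_, ?_, ?_, ?_, ?_⟩
  · intro v
    by_cases hv : v = u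
    · subst hv
      exact h.preflow.label_lt hlab hupos hus
    · simpa [PushState.relabel, hv] using h.label_lt v
  · intro w a ha
    by_cases hw : w = u
    · subst hw
      simpa [PushState.relabel, N.mem_adj] using ha
    · exact h.tail_cur w a (by simpa [PushState.relabel, hw] using ha)
  · intro a ha
    by_cases hw : N.tail a = u
    · refine absurd ?_ ha
      simpa [PushState.relabel, hw] using N.mem_adj.2 hw
    · have h1 := h.inadmissible a (by simpa [PushState.relabel, hw] using ha)
      refine h1.imp id fun h2 => ?_
      simp only [PushState.relabel]
      rw [Function.update_of_ne hw, Function.update_apply]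
      split_ifs with h4
      · rw [h4] at h2; omega
      · exact h2
  · intro k v hv
    rcases hmem' k v hv with ⟨rfl, rfl⟩ | ⟨h1, h2⟩
    · exact ⟨by simp [PushState.relabel, hlu], hus, hut⟩
    · simpa [PushState.relabel, h2] using h.bucket k v h1
  · intro k
    rw [hbk]
    split_ifs
    · simp
    · exact hnd.2
    · exact h.bucket_nodup k
  · intro v hv
    rw [hbk]
    by_cases h1 : v = u
    · subst h1
      simp [PushState.relabel, hlu]
    · have h2 := h.mem_bucket v hv
      have h3 : (s.relabel N u us).label v = s.label v := by simp [PushState.relabel, h1]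
      rw [h3]
      split_ifs with h4 h5
      · rw [h4, habove] at h2
        simp at h2
      · rw [h5, hb] at h2
        exact (List.mem_cons.1 h2).resolve_left h1
      · exact h2
  · intro k v hv hv0
    change s.excess v = 0 at hv0
    rcases hmem' k v hv with ⟨rfl, rfl⟩ | ⟨h1, h2⟩
    · exact absurd hv0 hu
    · have := (h.eq_head k v h1 hv0).2
      rw [hb, List.head?_cons, Option.some_inj] at this
      exact absurd this.symm h2
  · intro k hk
    change s.level + 1 < k at hk
    rw [hbk, if_neg (by omega), if_neg (by omega)]
    exact h.bucket_above k (by omega)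

/-- Flow is pushed along an admissible arc. -/
theorem Inv.push (h : s.Inv N X) {u : Fin n} {us : List (Fin n)} {a : Arc m} {as : List (Arc m)}
    (hb : s.bucket s.level = u :: us) (hu : s.excess u ≠ 0) (hc : s.cur u = a :: as)
    (ha : ¬ s.Inadmissible N X a) :
    Inv N X (s.push N a (min (s.excess u) (N.residual X s.flow a))) := by
  have hmem : u ∈ s.bucket s.level := by rw [hb]; exact List.mem_cons_self
  obtain ⟨hlu, hus, hut⟩ := h.bucket _ u hmem
  have htail : N.tail a = u := h.tail_cur u a (by rw [hc]; exact List.mem_cons_self)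
  obtain ⟨hres, hlab⟩ := (h.admissible_iff a).2 ha
  have hupos : 0 < s.excess u := lt_of_le_of_ne (h.preflow.excess_nonneg u hus) hu.symm
  set δ := min (s.excess u) (N.residual X s.flow a) with hδ
  have hδpos : 0 < δ := lt_min hupos hres
  have hδu : δ ≤ s.excess u := min_le_left _ _
  have hne : N.head a ≠ u := by
    intro h1
    rw [htail, h1] at hlab
    omega
  have hlv : s.label (N.head a) + 1 = s.level := by rw [← hlab, htail, hlu]
  have hex : ∀ w, w ≠ u → s.excess w ≤ (s.push N a δ).excess w := by
    intro w hw
    rw [push_excess, htail, if_neg hw]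
    split_ifs <;> linarith
  -- a node without excess is in no list, except possibly the one that is being treated
  have hnot : ∀ k, s.excess (N.head a) = 0 → N.head a ∉ s.bucket k := by
    intro k h0 h1
    have := (h.eq_head k _ h1 h0).2
    rw [hb, List.head?_cons, Option.some_inj] at this
    exact hne this.symm
  have hbk : ∀ k v, v ∈ (s.push N a δ).bucket k → v ∈ s.bucket k ∨
      (v = N.head a ∧ k = s.label (N.head a) ∧ v ≠ N.source ∧ v ≠ N.sink) := by
    intro k v hv
    simp only [PushState.push] at hv
    split_ifs at hv with h1
    · by_cases hk : k = s.label (N.head a)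
      · subst hk
        rw [Function.update_self, List.mem_cons] at hv
        rcases hv with rfl | hv
        · exact .inr ⟨rfl, rfl, h1.2.2⟩
        · exact .inl hv
      · rw [Function.update_of_ne hk] at hv
        exact .inl hv
    · exact .inl hv
  have hbk' : ∀ k v, v ∈ s.bucket k → v ∈ (s.push N a δ).bucket k := by
    intro k v hv
    simp only [PushState.push]
    split_ifs with h1
    · by_cases hk : k = s.label (N.head a)
      · subst hk
        rw [Function.update_self]
        exact List.mem_cons_of_mem _ hv
      · rwa [Function.update_of_ne hk]
    · exact hv
  have hlevel : (s.push N a δ).bucket s.level = s.bucket s.level := by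
    simp only [PushState.push]
    split_ifs with h1
    · rw [Function.update_of_ne (by omega)]
    · rfl
  refine ⟨isPreflow_push h.preflow hδpos.le (min_le_right _ _) (.inr (htail.symm ▸ hδu)),
    ⟨h.labelling.source, h.labelling.sink, ?_⟩, h.label_lt, h.tail_cur, ?_, ?_, ?_, ?_, ?_, ?_⟩
  · intro b hb'
    by_cases h1 : b = rev a
    · subst h1
      change s.label (N.tail (rev a)) ≤ s.label (N.head (rev a)) + 1
      rw [tail_rev, head_rev]
      omega
    · refine h.labelling.valid b (hb'.trans_le ?_)
      rw [push_residual, if_neg h1]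
      split_ifs <;> linarith
  · intro b hb'
    exact (h.inadmissible b hb').push hδpos.le (by omega)
  · intro k v hv
    rcases hbk k v hv with h1 | ⟨rfl, rfl, h1⟩
    · exact h.bucket k v h1
    · exact ⟨rfl, h1⟩
  · intro k
    simp only [PushState.push]
    split_ifs with h1
    · by_cases hk : k = s.label (N.head a)
      · subst hk
        rw [Function.update_self, List.nodup_cons]
        exact ⟨hnot _ h1.1, h.bucket_nodup _⟩
      · rw [Function.update_of_ne hk]
        exact h.bucket_nodup k
    · exact h.bucket_nodup k
  · intro v hv
    change v ∈ (s.push N a δ).bucket (s.label v)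
    by_cases h0 : 0 < s.excess v
    · exact hbk' _ _ (h.mem_bucket v ⟨h0, hv.2⟩)
    · have h1 : v = N.head a := by
        by_contra h1
        refine h0 (hv.1.trans_le ?_)
        rw [push_excess, if_neg h1]
        split_ifs <;> linarith
      subst h1
      have h2 : s.excess (N.head a) = 0 :=
        le_antisymm (not_lt.1 h0) (h.preflow.excess_nonneg _ hv.2.1)
      simp only [PushState.push]
      rw [if_pos ⟨h2, hδpos, hv.2⟩, Function.update_self]
      exact List.mem_cons_self
  · intro k v hv hv0
    change k = s.level ∧ ((s.push N a δ).bucket s.level).head? = some v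
    rw [hlevel]
    by_cases h1 : v = u
    · subst h1
      rw [hb]
      refine ⟨?_, rfl⟩
      rcases hbk k v hv with h2 | ⟨h2, -⟩
      · rw [← (h.bucket k v h2).1, hlu]
      · exact absurd h2.symm hne
    · have h2 : s.excess v = 0 := by
        rcases eq_or_ne v N.source with h3 | h3
        · rcases hbk k v hv with h4 | ⟨-, -, h4, -⟩
          · exact absurd h3 (h.bucket k v h4).2.1
          · exact absurd h3 h4
        · exact le_antisymm (hv0 ▸ hex v h1) (h.preflow.excess_nonneg v h3)
      rcases hbk k v hv with h3 | ⟨h3, -⟩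
      · exact h.eq_head k v h3 h2
      · subst h3
        rw [push_excess, if_neg (htail.symm ▸ h1), if_pos rfl] at hv0
        omega
  · intro k hk
    change s.level < k at hk
    simp only [PushState.push]
    split_ifs with h1
    · rw [Function.update_of_ne (by omega)]
      exact h.bucket_above k hk
    · exact h.bucket_above k hk

/-! ### The saturation of the arcs out of the source -/

variable (N X) in
/-- The invariants of the saturation of the arcs that leave the source, of which those in `as` are
still to be treated. -/
structure SatInv (s : PushState n m) (as : List (Arc m)) : Prop where
  preflow : N.IsPreflow X s.flow s.excess
  label : s.label = fun v => if v = N.source then n else 0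
  cur : s.cur = N.adj
  level : s.level = 0
  residual : ∀ a, N.tail a = N.source → N.head a ≠ N.source → 0 < N.residual X s.flow a → a ∈ as
  tail : ∀ a ∈ as, N.tail a = N.source
  bucket_pos : ∀ k, k ≠ 0 → s.bucket k = []
  bucket_nodup : (s.bucket 0).Nodup
  mem_bucket : ∀ v, v ∈ s.bucket 0 ↔ s.Active N v

theorem SatInv.start : SatInv N X (start N) (N.adj N.source) where
  preflow := by
    refine ⟨fun w => ?_, fun w _ => le_rfl, fun a => ?_⟩
    · simp [PushState.start, netIn]
    · simp only [PushState.start, Network.residual]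
      split_ifs <;> simp
  label := rfl
  cur := rfl
  level := rfl
  residual a ha _ _ := N.mem_adj.2 ha
  tail a ha := N.mem_adj.1 ha
  bucket_pos _ _ := rfl
  bucket_nodup := List.nodup_nil
  mem_bucket v := by simp [PushState.start, Active]

theorem SatInv.push {a : Arc m} {as : List (Arc m)} (h : SatInv N X s (a :: as)) :
    SatInv N X (s.push N a (N.residual X s.flow a)) as := by
  have htail := h.tail a List.mem_cons_self
  set δ := N.residual X s.flow a with hδ
  have hδ0 : 0 ≤ δ := h.preflow.residual_nonneg a
  have hex : ∀ w, w ≠ N.source → w ≠ N.head a →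
      (s.push N a δ).excess w = s.excess w := by
    intro w h1 h2
    rw [push_excess, htail, if_neg h1, if_neg h2]
    ring
  refine ⟨isPreflow_push h.preflow hδ0 le_rfl (.inl htail), h.label, h.cur, h.level, ?_,
    fun b hb => h.tail b (List.mem_cons_of_mem _ hb), ?_, ?_, ?_⟩
  · intro b h1 h2 h3
    have hrev : b ≠ rev a := by
      rintro rfl
      rw [head_rev, htail] at h2
      exact h2 rfl
    rw [push_residual, if_neg hrev] at h3
    rcases eq_or_ne b a with rfl | h4
    · simp [← hδ] at h3
    · rw [if_neg h4] at h3
      exact (List.mem_cons.1 (h.residual b h1 h2 (by linarith))).resolve_left h4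
  · intro k hk
    simp only [PushState.push]
    split_ifs with h1
    · have h2 : s.label (N.head a) = 0 := by rw [h.label]; simp [h1.2.2.1]
      rw [h2, Function.update_of_ne hk]
      exact h.bucket_pos k hk
    · exact h.bucket_pos k hk
  · simp only [PushState.push]
    split_ifs with h1
    · have h2 : s.label (N.head a) = 0 := by rw [h.label]; simp [h1.2.2.1]
      rw [h2, Function.update_self, List.nodup_cons]
      refine ⟨fun h3 => ?_, h.bucket_nodup⟩
      exact absurd h1.1 ((h.mem_bucket _).1 h3).1.ne'
    · exact h.bucket_nodup
  · intro v
    by_cases hv : v ≠ N.source ∧ v ≠ N.sink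
    · by_cases h1 : v = N.head a
      · subst h1
        have h2 : s.label (N.head a) = 0 := by rw [h.label]; simp [hv.1]
        have h3 : (s.push N a δ).excess (N.head a) = s.excess (N.head a) + δ := by
          rw [push_excess, htail, if_neg hv.1, if_pos rfl]
          ring
        have h4 := h.preflow.excess_nonneg _ hv.1
        have h5 := h.mem_bucket (N.head a)
        simp only [Active, hv, ne_eq, not_false_eq_true, and_true] at h5 ⊢
        rw [h3]
        simp only [PushState.push]
        split_ifs with h6
        · simp [h2, h6.1, h6.2.1]
        · rw [h5]
          have : ¬ (s.excess (N.head a) = 0 ∧ 0 < δ) := fun h7 => h6 ⟨h7.1, h7.2, hv⟩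
          omega
      · have h3 := h.mem_bucket v
        simp only [Active, hv, ne_eq, not_false_eq_true, and_true] at h3 ⊢
        rw [hex v hv.1 h1, ← h3]
        simp only [PushState.push]
        split_ifs with h6
        · have h2 : s.label (N.head a) = 0 := by rw [h.label]; simp [h6.2.2.1]
          simp [h2, h1]
        · rfl
    · have h1 := h.mem_bucket v
      have h2 : ¬ s.Active N v := fun h3 => hv h3.2
      have h3 : ¬ (s.push N a δ).Active N v := fun h3 => hv h3.2
      refine iff_of_false (fun h4 => ?_) h3
      simp only [PushState.push] at h4
      split_ifs at h4 with h6
      · have h7 : s.label (N.head a) = 0 := by rw [h.label]; simp [h6.2.2.1]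
        rw [h7, Function.update_self, List.mem_cons] at h4
        rcases h4 with rfl | h4
        · exact hv h6.2.2
        · exact h2 (h1.1 h4)
      · exact h2 (h1.1 h4)

theorem SatInv.inv (h : SatInv N X s []) : s.Inv N X where
  preflow := h.preflow
  labelling := by
    refine ⟨by simp [h.label], by simp [h.label, N.source_ne_sink.symm], fun a ha => ?_⟩
    simp only [h.label]
    by_cases h1 : N.tail a = N.source
    · by_cases h2 : N.head a = N.source
      · simp [h1, h2]
      · simpa using h.residual a h1 h2 ha
    · simp [h1]
  label_lt v := by
    have := N.two_le_nodes
    simp only [h.label]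
    split_ifs <;> omega
  tail_cur u a ha := N.mem_adj.1 (h.cur ▸ ha)
  inadmissible a ha := absurd (N.mem_adj.2 rfl) (h.cur ▸ ha)
  bucket k v hv := by
    rcases eq_or_ne k 0 with rfl | hk
    · have := ((h.mem_bucket v).1 hv).2
      exact ⟨by simp [h.label, this.1], this⟩
    · simp [h.bucket_pos k hk] at hv
  bucket_nodup k := by
    rcases eq_or_ne k 0 with rfl | hk
    · exact h.bucket_nodup
    · simp [h.bucket_pos k hk]
  mem_bucket v hv := by
    have : s.label v = 0 := by simp [h.label, hv.2.1]
    rw [this]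
    exact (h.mem_bucket v).2 hv
  eq_head k v hv hv0 := by
    rcases eq_or_ne k 0 with rfl | hk
    · exact absurd hv0 ((h.mem_bucket v).1 hv).1.ne'
    · simp [h.bucket_pos k hk] at hv
  bucket_above k hk := h.bucket_pos k (by omega)

end PushState

/-! ### The potential of the preflow-push algorithm -/

/-- The nodes with which some edge is incident. -/
def Network.nonIsolated {n m : ℕ} (N : Network n m) : Finset (Fin n) :=
  Finset.univ.filter fun v => N.adj v ≠ []

theorem Network.card_nonIsolated_le {n m : ℕ} (N : Network n m) : N.nonIsolated.card ≤ n :=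
  (Finset.card_le_univ _).trans_eq (Fintype.card_fin n)

theorem Network.card_nonIsolated_le_arcs {n m : ℕ} (N : Network n m) :
    N.nonIsolated.card ≤ 2 * m := by
  rw [← N.sum_length_adj, Finset.card_eq_sum_ones]
  refine (Finset.sum_le_sum fun v hv => ?_).trans
    (Finset.sum_le_univ_sum_of_nonneg (f := fun u => (N.adj u).length) fun _ => Nat.zero_le _)
  exact List.length_pos_iff.2 (Finset.mem_filter.1 hv).2

namespace PushState

open Network

variable {n m : ℕ} (N : Network n m) (X : StateVec m) (s : PushState n m)

/-- The number of non-isolated nodes whose labels are at most that of `v`. -/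
def rank (v : Fin n) : ℕ := (N.nonIsolated.filter fun w => s.label w ≤ s.label v).card

open Classical in
/-- The set of the active nodes. -/
noncomputable def actives : Finset (Fin n) := Finset.univ.filter (s.Active N)

/-- The total rank of the active nodes. -/
noncomputable def rankSum : ℕ := ∑ v ∈ s.actives N, s.rank N v

/-- The number of active nodes on the level that is being treated. -/
noncomputable def topCount : ℕ := ((s.actives N).filter fun v => s.label v = s.level).card

open Classical in
/-- Twice the number of the arcs in a rest of an adjacency list, less one if flow cannot be pushed
along the first of them. It is lowered when an arc is passed over and also when it is saturated. -/
noncomputable def scanCost : List (Arc m) → ℕ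
  | [] => 0
  | a :: as => 2 * as.length + if s.Inadmissible N X a then 1 else 2

/-- What remains of the scans of the adjacency lists, those after future relabellings included. -/
noncomputable def scanPot : ℕ :=
  ∑ v, (s.scanCost N X (s.cur v) + 2 * (N.adj v).length * (2 * n - s.label v))

/-- What remains of the relabellings. -/
def labelPot : ℕ := ∑ v ∈ N.nonIsolated, (2 * n - s.label v)

/-- This is `1` if the node that is being treated has just been emptied by a push, and `0`
otherwise. -/
def spent : ℕ := if ((s.bucket s.level).head?.any fun u => s.excess u = 0) then 1 else 0

/-- A potential that drops by at least `K` with every transition of the main loop. A push that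
empties a node of the level `ℓ` lowers `rankSum` by the number of the nodes with label `ℓ`. If there
are fewer than `K` of these, it lowers the minimum of `K` and `topCount` instead; as this minimum is
at most `K`, its growth when the level changes is paid for by `level` and `labelPot`. -/
noncomputable def potential (K : ℕ) : ℕ :=
  (2 * N.nonIsolated.card + 2 * K) * s.scanPot N X +
    (2 * N.nonIsolated.card + 4 * K ^ 2 + 2 * K) * s.labelPot N +
    (2 * K ^ 2 + K) * s.level + 2 * (s.rankSum N + K * min K (s.topCount N)) + K * s.spent

variable {N X s}

theorem sum_insert_le {α : Type*} [DecidableEq α] (a : α) (S : Finset α) (f : α → ℕ) :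
    ∑ v ∈ insert a S, f v ≤ f a + ∑ v ∈ S, f v := by
  by_cases h : a ∈ S
  · rw [Finset.insert_eq_of_mem h]
    exact Nat.le_add_left _ _
  · rw [Finset.sum_insert h]

theorem mem_actives {v : Fin n} : v ∈ s.actives N ↔ s.Active N v := by
  simp [actives]

theorem rank_le (v : Fin n) : s.rank N v ≤ N.nonIsolated.card :=
  Finset.card_filter_le _ _

theorem spent_le_one : s.spent ≤ 1 := by
  unfold spent
  split_ifs <;> omega

theorem spent_eq_one {u : Fin n} {us : List (Fin n)} (hb : s.bucket s.level = u :: us)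
    (hu : s.excess u = 0) : s.spent = 1 := by
  simp [spent, hb, hu]

theorem spent_eq_zero (h : ∀ u, (s.bucket s.level).head? = some u → s.excess u ≠ 0) :
    s.spent = 0 := by
  unfold spent
  rw [if_neg]
  cases hb : (s.bucket s.level).head? with
  | none => simp
  | some u => simpa using h u hb

theorem Inv.actives_subset (h : s.Inv N X) : s.actives N ⊆ N.nonIsolated := by
  intro v hv
  rw [mem_actives] at hv
  exact Finset.mem_filter.2 ⟨Finset.mem_univ _, h.preflow.adj_ne_nil hv.1.ne'⟩

theorem Inv.topCount_le (h : s.Inv N X) :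
    s.topCount N ≤ (N.nonIsolated.filter fun w => s.label w = s.level).card :=
  Finset.card_le_card (Finset.filter_subset_filter _ h.actives_subset)

/-- The scan cost of a list does not rise as long as inadmissible arcs stay inadmissible. -/
theorem scanCost_le {s' : PushState n m} (as : List (Arc m))
    (h : ∀ a ∈ as, s.Inadmissible N X a → s'.Inadmissible N X a) :
    s'.scanCost N X as ≤ s.scanCost N X as := by
  cases as with
  | nil => exact le_rfl
  | cons a as =>
    have := h a List.mem_cons_self
    simp only [scanCost]
    split_ifs with h1 h2 h2
    · exact le_rfl
    · omega
    · exact absurd (this h2) h1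
    · exact le_rfl

theorem scanCost_le_length (as : List (Arc m)) : s.scanCost N X as ≤ 2 * as.length := by
  cases as with
  | nil => exact le_rfl
  | cons a as =>
    simp only [scanCost, List.length_cons]
    split_ifs <;> omega

theorem potential_pop {K : ℕ} (h : s.Inv N X) {u : Fin n} {us : List (Fin n)}
    (hb : s.bucket s.level = u :: us) (hu : s.excess u = 0) :
    potential N X { s with bucket := Function.update s.bucket s.level us } K + K ≤
      s.potential N X K := by
  have h0 : spent { s with bucket := Function.update s.bucket s.level us } = 0 := by
    refine spent_eq_zero fun v hv hv0 => ?_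
    simp only [Function.update_self] at hv
    have hmem : v ∈ us := List.mem_of_mem_head? hv
    have h1 := (h.eq_head s.level v (by rw [hb]; exact List.mem_cons_of_mem _ hmem) hv0).2
    rw [hb, List.head?_cons, Option.some_inj] at h1
    have hnd := h.bucket_nodup s.level
    rw [hb, List.nodup_cons] at hnd
    exact hnd.1 (h1 ▸ hmem)
  unfold potential
  rw [h0, spent_eq_one hb hu]
  exact le_of_eq (by simp only [mul_zero, add_zero, mul_one]; rfl)

theorem potential_lower {K : ℕ} (h : s.Inv N X) (hb : s.bucket s.level = [])
    (hl : s.level ≠ 0) :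
    potential N X { s with level := s.level - 1 } K + K ≤ s.potential N X K := by
  have h0 : spent { s with level := s.level - 1 } = 0 := by
    refine spent_eq_zero fun v hv hv0 => ?_
    have h1 := (h.eq_head _ v (List.mem_of_mem_head? hv) hv0).2
    simp [hb] at h1
  obtain ⟨l, hl'⟩ := Nat.exists_eq_succ_of_ne_zero hl
  unfold potential
  rw [h0]
  have h1 : K * min K (topCount N { s with level := s.level - 1 }) ≤ K ^ 2 := by
    rw [pow_two]
    exact Nat.mul_le_mul_left _ (min_le_left _ _)
  have h2 : (2 * K ^ 2 + K) * s.level = (2 * K ^ 2 + K) * (s.level - 1) + 2 * K ^ 2 + K := by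
    rw [hl']
    simp only [Nat.succ_eq_add_one, Nat.add_sub_cancel]
    ring
  have h3 : scanPot N X { s with level := s.level - 1 } = s.scanPot N X := rfl
  have h4 : labelPot N { s with level := s.level - 1 } = s.labelPot N := rfl
  have h5 : rankSum N { s with level := s.level - 1 } = s.rankSum N := rfl
  rw [h2, h3, h4, h5]
  simp only
  omega

theorem potential_scan {K : ℕ} {u : Fin n} {a : Arc m} {as : List (Arc m)}
    (hc : s.cur u = a :: as) :
    potential N X { s with cur := Function.update s.cur u as } K + K ≤ s.potential N X K := by
  have h1 : scanPot N X { s with cur := Function.update s.cur u as } + 1 ≤ s.scanPot N X := by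
    unfold scanPot
    rw [Nat.succ_le_iff]
    have h2 : scanCost N X { s with cur := Function.update s.cur u as } as <
        s.scanCost N X (s.cur u) := by
      refine (scanCost_le_length as).trans_lt ?_
      rw [hc]
      simp only [scanCost]
      split_ifs <;> omega
    refine Finset.sum_lt_sum (fun v _ => ?_) ⟨u, Finset.mem_univ _, ?_⟩
    · refine Nat.add_le_add_right ?_ _
      by_cases hv : v = u
      · subst hv
        simpa using h2.le
      · simp only [Function.update_of_ne hv]
        exact scanCost_le _ fun _ _ h => h
    · refine Nat.add_lt_add_right ?_ _
      simpa using h2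
  unfold potential
  have h3 := Nat.mul_le_mul_left (2 * N.nonIsolated.card + 2 * K) h1
  rw [Nat.mul_add, Nat.mul_one] at h3
  have h4 : labelPot N { s with cur := Function.update s.cur u as } = s.labelPot N := rfl
  have h5 : rankSum N { s with cur := Function.update s.cur u as } = s.rankSum N := rfl
  have h6 : topCount N { s with cur := Function.update s.cur u as } = s.topCount N := rfl
  have h7 : spent { s with cur := Function.update s.cur u as } = s.spent := rfl
  rw [h4, h5, h6, h7]
  simp only
  omega

theorem potential_relabel {K : ℕ} (h : s.Inv N X) {u : Fin n} {us : List (Fin n)}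
    (hb : s.bucket s.level = u :: us) (hu : s.excess u ≠ 0) (hc : s.cur u = []) :
    (s.relabel N u us).potential N X K + K ≤ s.potential N X K := by
  have h' := h.relabel hb hu hc
  have hmem : u ∈ s.bucket s.level := by rw [hb]; exact List.mem_cons_self
  obtain ⟨hlu, hus, hut⟩ := h.bucket _ u hmem
  have hlab : (s.relabel N u us).label = Function.update s.label u (s.label u + 1) := rfl
  have hlt : s.label u + 1 < 2 * n := by
    have := h'.label_lt u
    rwa [hlab, Function.update_self] at this
  have hact : (s.relabel N u us).actives N = s.actives N := rfl
  have huact : u ∈ s.actives N :=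
    mem_actives.2 ⟨lt_of_le_of_ne (h.preflow.excess_nonneg u hus) hu.symm, hus, hut⟩
  have h0 : (s.relabel N u us).spent = 0 := by
    refine spent_eq_zero fun v hv => ?_
    have : (s.relabel N u us).bucket (s.relabel N u us).level = u :: s.bucket (s.level + 1) := by
      simp [PushState.relabel]
    rw [this, List.head?_cons, Option.some_inj] at hv
    exact hv ▸ hu
  have h1 : (s.relabel N u us).scanPot N X ≤ s.scanPot N X := by
    unfold scanPot
    refine Finset.sum_le_sum fun v _ => ?_
    by_cases hv : v = u
    · subst hv
      have e1 : (s.relabel N v us).cur v = N.adj v := by simp [PushState.relabel]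
      have e2 := scanCost_le_length (N := N) (X := X) (s := s.relabel N v us) (N.adj v)
      have e3 : 2 * n - s.label v = 2 * n - (s.label v + 1) + 1 := by omega
      rw [e1, hlab, Function.update_self, e3, hc, Nat.mul_add]
      omega
    · have e1 : (s.relabel N u us).cur v = s.cur v := by simp [PushState.relabel, hv]
      rw [e1, hlab, Function.update_of_ne hv]
      refine Nat.add_le_add_right (scanCost_le (s := s) (s' := s.relabel N u us) _
        fun a ha h1 => h1.imp id fun h2 => ?_) _
      have h3 : N.tail a ≠ u := by rwa [h.tail_cur v a ha]
      rw [hlab, Function.update_of_ne h3, Function.update_apply]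
      split_ifs with h4
      · rw [h4] at h2; omega
      · exact h2
  have h2 : (s.relabel N u us).labelPot N + 1 ≤ s.labelPot N := by
    unfold labelPot
    rw [Nat.succ_le_iff]
    refine Finset.sum_lt_sum (fun v _ => ?_) ⟨u, h.actives_subset huact, ?_⟩
    · rw [hlab, Function.update_apply]
      split_ifs with hv
      · subst hv; omega
      · exact le_rfl
    · rw [hlab, Function.update_self]
      omega
  have h3 : (s.relabel N u us).rankSum N ≤ s.rankSum N + N.nonIsolated.card := by
    unfold rankSum
    rw [hact, ← Finset.add_sum_erase _ _ huact, ← Finset.add_sum_erase _ (s.rank N) huact]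
    have e1 : ∑ v ∈ (s.actives N).erase u, (s.relabel N u us).rank N v ≤
        ∑ v ∈ (s.actives N).erase u, s.rank N v := by
      refine Finset.sum_le_sum fun v hv => Finset.card_le_card fun w hw => ?_
      rw [Finset.mem_filter, hlab, Function.update_of_ne (Finset.ne_of_mem_erase hv),
        Function.update_apply] at hw
      refine Finset.mem_filter.2 ⟨hw.1, ?_⟩
      have := hw.2
      split_ifs at this with h4
      · subst h4; omega
      · exact this
    have e2 := rank_le (N := N) (s := s.relabel N u us) u
    omega
  have h4 : K * min K ((s.relabel N u us).topCount N) ≤ K ^ 2 := by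
    rw [pow_two]
    exact Nat.mul_le_mul_left _ (min_le_left _ _)
  have h5 : (s.relabel N u us).level = s.level + 1 := rfl
  unfold potential
  have h6 := Nat.mul_le_mul_left (2 * N.nonIsolated.card + 4 * K ^ 2 + 2 * K) h2
  have h7 := Nat.mul_le_mul_left (2 * N.nonIsolated.card + 2 * K) h1
  rw [Nat.mul_add, Nat.mul_one] at h6
  rw [h0, h5, Nat.mul_add (2 * K ^ 2 + K)]
  omega

theorem potential_push {K : ℕ} (h : s.Inv N X) {u : Fin n} {us : List (Fin n)} {a : Arc m}
    {as : List (Arc m)} (hb : s.bucket s.level = u :: us) (hu : s.excess u ≠ 0)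
    (hc : s.cur u = a :: as) (ha : ¬ s.Inadmissible N X a) :
    (s.push N a (min (s.excess u) (N.residual X s.flow a))).potential N X K + K ≤
      s.potential N X K := by
  have hmem : u ∈ s.bucket s.level := by rw [hb]; exact List.mem_cons_self
  obtain ⟨hlu, hus, hut⟩ := h.bucket _ u hmem
  have htail : N.tail a = u := h.tail_cur u a (by rw [hc]; exact List.mem_cons_self)
  obtain ⟨hres, hlab⟩ := (h.admissible_iff a).2 ha
  have hupos : 0 < s.excess u := lt_of_le_of_ne (h.preflow.excess_nonneg u hus) hu.symm
  have huact : u ∈ s.actives N := mem_actives.2 ⟨hupos, hus, hut⟩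
  set δ := min (s.excess u) (N.residual X s.flow a) with hδ
  have hδpos : 0 < δ := lt_min hupos hres
  have hlv : s.label (N.head a) + 1 = s.level := by rw [← hlab, htail, hlu]
  have hne : N.head a ≠ u := by
    intro h1
    rw [h1, hlu] at hlv
    omega
  set s' := s.push N a δ with hs'
  have hlabel : s'.label = s.label := rfl
  have hlevel : s'.level = s.level := rfl
  have hcur : s'.cur = s.cur := rfl
  have hinadm : ∀ b, s.Inadmissible N X b → s'.Inadmissible N X b :=
    fun b hb' => hb'.push hδpos.le (by omega)
  have h0 : s.spent = 0 := by
    refine spent_eq_zero fun v hv => ?_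
    rw [hb, List.head?_cons, Option.some_inj] at hv
    exact hv ▸ hu
  have h0' : s'.spent ≤ 1 := spent_le_one
  have hact : ∀ v ∈ s'.actives N, v = N.head a ∨ v ∈ s.actives N := by
    intro v hv
    rw [mem_actives] at hv ⊢
    by_contra hcon
    push Not at hcon
    refine hcon.2 ⟨hv.1.trans_le ?_, hv.2⟩
    rw [hs', push_excess, if_neg hcon.1]
    split_ifs <;> linarith
  have hrank : ∀ v, s'.rank N v = s.rank N v := fun _ => rfl
  have hlabelPot : s'.labelPot N = s.labelPot N := rfl
  have hscan : s'.scanPot N X ≤ s.scanPot N X := by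
    unfold scanPot
    exact Finset.sum_le_sum fun v _ => Nat.add_le_add_right (scanCost_le _ fun b _ => hinadm b) _
  have htop : s'.topCount N ≤ s.topCount N := by
    refine Finset.card_le_card fun v hv => ?_
    rw [Finset.mem_filter, hlabel, hlevel] at hv
    refine Finset.mem_filter.2 ⟨(hact v hv.1).resolve_left ?_, hv.2⟩
    rintro rfl
    have := hv.2
    omega
  rcases le_or_gt (N.residual X s.flow a) (s.excess u) with hsat | hnon
  · -- the push saturates the arc `a`
    have hscan' : s'.scanPot N X + 1 ≤ s.scanPot N X := by
      unfold scanPot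
      rw [Nat.succ_le_iff]
      refine Finset.sum_lt_sum
        (fun v _ => Nat.add_le_add_right (scanCost_le _ fun b _ => hinadm b) _)
        ⟨u, Finset.mem_univ _, Nat.add_lt_add_right ?_ _⟩
      have h1 : s'.Inadmissible N X a := by
        refine .inl ?_
        have h2 : a ≠ rev a := by
          intro h2
          have := congrArg N.tail h2
          rw [tail_rev, htail] at this
          exact hne this.symm
        rw [hs', push_residual, if_pos rfl, if_neg h2, hδ, min_eq_right hsat]
        simp
      rw [hcur, hc]
      simp [scanCost, h1, ha]
    have hsum : s'.rankSum N ≤ s.rankSum N + N.nonIsolated.card := by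
      unfold rankSum
      calc ∑ v ∈ s'.actives N, s'.rank N v ≤ ∑ v ∈ insert (N.head a) (s.actives N), s.rank N v :=
            Finset.sum_le_sum_of_subset fun v hv => Finset.mem_insert.2 (hact v hv)
        _ ≤ s.rank N (N.head a) + ∑ v ∈ s.actives N, s.rank N v := sum_insert_le _ _ _
        _ ≤ _ := by have := rank_le (N := N) (s := s) (N.head a); omega
    have h1 := Nat.mul_le_mul_left (2 * N.nonIsolated.card + 2 * K) hscan'
    have h2 : K * min K (s'.topCount N) ≤ K * min K (s.topCount N) :=
      Nat.mul_le_mul_left _ (min_le_min_left _ htop)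
    have h3 : K * s'.spent ≤ K := (Nat.mul_le_mul_left K h0').trans_eq (mul_one K)
    rw [Nat.mul_add, Nat.mul_one] at h1
    unfold potential
    rw [h0, hlevel, hlabelPot]
    omega
  · -- the push empties the node `u`
    have hu0 : s'.excess u = 0 := by
      rw [hs', push_excess, htail, if_pos rfl, if_neg hne.symm, hδ, min_eq_left hnon.le]
      simp
    have hact' : ∀ v ∈ s'.actives N, v ≠ u := by
      rintro v hv rfl
      exact absurd hu0 (mem_actives.1 hv).1.ne'
    have htop' : s'.topCount N + 1 ≤ s.topCount N := by
      rw [Nat.succ_le_iff]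
      refine Finset.card_lt_card ((Finset.ssubset_iff_of_subset fun v hv => ?_).2 ⟨u, ?_, ?_⟩)
      · rw [Finset.mem_filter, hlabel, hlevel] at hv
        refine Finset.mem_filter.2 ⟨(hact v hv.1).resolve_left ?_, hv.2⟩
        rintro rfl
        have := hv.2
        omega
      · exact Finset.mem_filter.2 ⟨huact, hlu⟩
      · intro h1
        exact hact' u (Finset.mem_filter.1 h1).1 rfl
    have hsum : s'.rankSum N + (N.nonIsolated.filter fun w => s.label w = s.level).card ≤
        s.rankSum N := by
      have e1 : s.rank N (N.head a) + (N.nonIsolated.filter fun w => s.label w = s.level).card =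
          s.rank N u := by
        unfold rank
        rw [← Finset.card_union_of_disjoint]
        · congr 1
          ext w
          simp only [Finset.mem_union, Finset.mem_filter]
          rw [hlu, ← and_or_left]
          refine and_congr_right fun _ => ?_
          omega
        · rw [Finset.disjoint_filter]
          intro w _ h1
          omega
      have e2 : s'.rankSum N ≤ s.rank N (N.head a) + ∑ v ∈ (s.actives N).erase u, s.rank N v := by
        unfold rankSum
        refine (Finset.sum_le_sum_of_subset fun v hv => ?_).trans (sum_insert_le _ _ _)
        exact Finset.mem_insert.2 ((hact v hv).imp id fun h1 => Finset.mem_erase.2 ⟨hact' v hv, h1⟩)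
      have e3 : s.rankSum N = s.rank N u + ∑ v ∈ (s.actives N).erase u, s.rank N v :=
        (Finset.add_sum_erase _ _ huact).symm
      omega
    have h1 := Nat.mul_le_mul_left (2 * N.nonIsolated.card + 2 * K) hscan
    have h3 : K * s'.spent ≤ K := (Nat.mul_le_mul_left K h0').trans_eq (mul_one K)
    have h2 : s'.rankSum N + K * min K (s'.topCount N) + K ≤
        s.rankSum N + K * min K (s.topCount N) := by
      have h4 := h.topCount_le
      rcases le_or_gt K (s.topCount N) with h5 | h5
      · have := Nat.mul_le_mul_left K (min_le_min_left K htop)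
        omega
      · rw [min_eq_right (by omega), min_eq_right h5.le]
        have := Nat.mul_le_mul_left K htop'
        rw [Nat.mul_add, Nat.mul_one] at this
        omega
    unfold potential
    rw [h0, hlevel, hlabelPot]
    omega

/-! ### The running time of the preflow-push algorithm -/

/-- A transition of the main loop ends the run, or it keeps the invariants and lowers the
potential. -/
theorem Inv.mainStep (h : s.Inv N X) (K : ℕ) : (s.mainStep N X).stage = .done ∨
    (s.mainStep N X).stage = s.stage ∧ (s.mainStep N X).Inv N X ∧
      (s.mainStep N X).potential N X K + K ≤ s.potential N X K := by
  unfold PushState.mainStep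
  split
  · next hb =>
    split_ifs with hl
    · exact .inl rfl
    · exact .inr ⟨rfl, h.lower hb, potential_lower h hb hl⟩
  · next u us hb =>
    split_ifs with hu
    · exact .inr ⟨rfl, h.pop hb hu, potential_pop h hb hu⟩
    · split
      · next hc => exact .inr ⟨rfl, h.relabel hb hu hc, potential_relabel h hb hu hc⟩
      · next a as hc =>
        have htail : N.tail a = u := h.tail_cur u a (by rw [hc]; exact List.mem_cons_self)
        have hadm := h.admissible_iff a
        rw [htail] at hadm
        split_ifs with ha
        · rw [hadm] at ha
          exact .inr ⟨rfl, h.push hb hu hc ha, potential_push h hb hu hc ha⟩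
        · rw [hadm, not_not] at ha
          exact .inr ⟨rfl, h.scan hc ha, potential_scan hc⟩

theorem haltsIn_main {K : ℕ} (hK : 0 < K) (s : PushState n m) (h : s.Inv N X)
    (hs : s.stage = .main) :
    ∃ t, HaltsIn (step N X) s t ∧ K * t ≤ s.potential N X K + K := by
  induction hk : s.potential N X K using Nat.strong_induction_on generalizing s with
  | _ k ih =>
    have hstep : s.step N X = some (s.mainStep N X) := by
      simp [step, hs]
    rcases h.mainStep K with hd | ⟨h1, h2, h3⟩
    · refine ⟨1, .next hstep (.halt (by simp [step, hd])), by omega⟩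
    · obtain ⟨t, ht, hle⟩ := ih _ (by omega) _ h2 (h1.trans hs) rfl
      refine ⟨t + 1, .next hstep ht, ?_⟩
      rw [Nat.mul_add]
      omega

theorem SatInv.setStage {as : List (Arc m)} (h : SatInv N X s as) (st : PushStage m) :
    SatInv N X { s with stage := st } as :=
  ⟨h.preflow, h.label, h.cur, h.level, h.residual, h.tail, h.bucket_pos, h.bucket_nodup,
    h.mem_bucket⟩

theorem SatInv.potential_le (h : SatInv N X s []) (K : ℕ) : s.potential N X K ≤
    (2 * N.nonIsolated.card + 2 * K) * (4 * m + 8 * (n * m)) +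
      (2 * N.nonIsolated.card + 4 * K ^ 2 + 2 * K) * (N.nonIsolated.card * (2 * n)) +
      2 * (N.nonIsolated.card * N.nonIsolated.card + K ^ 2) + K := by
  have h1 : s.scanPot N X ≤ 4 * m + 8 * (n * m) := by
    have : 4 * m + 8 * (n * m) = ∑ v, (2 * (N.adj v).length + 2 * (N.adj v).length * (2 * n)) := by
      rw [Finset.sum_add_distrib, ← Finset.sum_mul, ← Finset.mul_sum, N.sum_length_adj]
      ring
    rw [this]
    refine Finset.sum_le_sum fun v _ => Nat.add_le_add ?_ (Nat.mul_le_mul_left _ (Nat.sub_le _ _))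
    rw [h.cur]
    exact scanCost_le_length _
  have h2 : s.labelPot N ≤ N.nonIsolated.card * (2 * n) := by
    refine (Finset.sum_le_card_nsmul _ _ (2 * n) fun v _ => Nat.sub_le _ _).trans_eq ?_
    rw [smul_eq_mul]
  have h3 : s.rankSum N ≤ N.nonIsolated.card * N.nonIsolated.card := by
    refine (Finset.sum_le_card_nsmul _ _ _ fun v _ => rank_le v).trans ?_
    rw [smul_eq_mul]
    exact Nat.mul_le_mul_right _ (Finset.card_le_card h.inv.actives_subset)
  have h4 : K * min K (s.topCount N) ≤ K ^ 2 := by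
    rw [pow_two]
    exact Nat.mul_le_mul_left _ (min_le_left _ _)
  have h5 : K * s.spent ≤ K := (Nat.mul_le_mul_left K spent_le_one).trans_eq (mul_one K)
  have h6 := Nat.mul_le_mul_left (2 * N.nonIsolated.card + 2 * K) h1
  have h7 := Nat.mul_le_mul_left (2 * N.nonIsolated.card + 4 * K ^ 2 + 2 * K) h2
  unfold potential
  rw [h.level]
  omega

/-- With `K` of the order of `√m`, the main loop takes time `O(n m + n² √m)`. -/
theorem SatInv.haltsWithin_main {K : ℕ} (hK : 0 < K) (hmK : m ≤ K ^ 2) (h : SatInv N X s [])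
    (hs : s.stage = .main) :
    HaltsWithin (step N X) s (24 * (n * m) + 52 * (n ^ 2 * K)) := by
  obtain ⟨t, ht, hle⟩ := haltsIn_main hK s h.inv hs
  refine ⟨t, Nat.le_of_mul_le_mul_left (hle.trans ?_) hK, ht⟩
  have hpot := h.potential_le K
  have hn : 1 ≤ n := le_trans one_le_two N.two_le_nodes
  have hr := N.card_nonIsolated_le
  have hr' := N.card_nonIsolated_le_arcs
  set r := N.nonIsolated.card
  have e0 : m ≤ n * m := Nat.le_mul_of_pos_left _ hn
  have e1 : n * m * r ≤ n ^ 2 * K ^ 2 := by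
    calc n * m * r ≤ n * K ^ 2 * n := by gcongr
      _ = _ := by ring
  have e2 : n * r * r ≤ 2 * (n ^ 2 * K ^ 2) := by
    calc n * r * r ≤ n * n * (2 * K ^ 2) := by gcongr; omega
      _ = _ := by ring
  have e3 : n * r * K ^ 2 ≤ n ^ 2 * K ^ 2 := by
    calc n * r * K ^ 2 ≤ n * n * K ^ 2 := by gcongr
      _ = _ := by ring
  have e4 : n * r * K ≤ n ^ 2 * K ^ 2 := by
    calc n * r * K ≤ n * n * K ^ 2 := by
          gcongr
          exact Nat.le_self_pow two_ne_zero K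
      _ = _ := by ring
  have e5 : r * r ≤ n * r * r := by
    rw [mul_assoc]
    exact Nat.le_mul_of_pos_left _ hn
  have e6 : K ^ 2 ≤ n ^ 2 * K ^ 2 := Nat.le_mul_of_pos_left _ (by positivity)
  have e7 : K ≤ K ^ 2 := Nat.le_self_pow two_ne_zero K
  calc s.potential N X K + K ≤ (2 * r + 2 * K) * (4 * m + 8 * (n * m)) +
      (2 * r + 4 * K ^ 2 + 2 * K) * (r * (2 * n)) + 2 * (r * r + K ^ 2) + K + K := by omega
    _ ≤ (2 * r + 2 * K) * (12 * (n * m)) +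
      (2 * r + 4 * K ^ 2 + 2 * K) * (r * (2 * n)) + 2 * (r * r + K ^ 2) + K + K := by
        gcongr
        omega
    _ = 24 * (n * m * r) + 24 * (K * (n * m)) + 4 * (n * r * r) + 8 * (n * r * K ^ 2) +
        4 * (n * r * K) + 2 * (r * r) + 2 * K ^ 2 + 2 * K := by ring
    _ ≤ 24 * (K * (n * m)) + 52 * (n ^ 2 * K ^ 2) := by omega
    _ = K * (24 * (n * m) + 52 * (n ^ 2 * K)) := by ring

/-- The running time of the highest-label preflow-push algorithm. -/
theorem haltsWithin_start {K : ℕ} (hK : 0 < K) (hmK : m ≤ K ^ 2) :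
    HaltsWithin (step N X) (start N) (24 * (n * m) + 52 * (n ^ 2 * K) + 3 * m + 5 * n + 2) := by
  have hsat : ∀ (as : List (Arc m)) (s : PushState n m), SatInv N X s as →
      s.stage = .saturate as →
      HaltsWithin (step N X) s (24 * (n * m) + 52 * (n ^ 2 * K) + 1 + as.length) := by
    intro as
    induction as with
    | nil =>
      intro s h hs
      exact ((h.setStage .main).haltsWithin_main hK hmK rfl).next (by simp [step, hs])
    | cons a as ih =>
      intro s h hs
      exact (ih _ (h.push.setStage (.saturate as)) rfl).next (by simp [step, hs])
  have halloc : ∀ (k : ℕ),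
      HaltsWithin (step N X) { start N with stage := .alloc k }
        (24 * (n * m) + 52 * (n ^ 2 * K) + 1 + (N.adj N.source).length + 1 + k) := by
    intro k
    induction k with
    | zero =>
      exact (hsat _ _ (SatInv.start.setStage (.saturate (N.adj N.source))) rfl).next rfl
    | succ k ih => exact ih.next rfl
  refine (halloc (m + 5 * n)).mono ?_
  have : (N.adj N.source).length ≤ 2 * m := by
    rw [← N.sum_length_adj]
    exact Finset.single_le_sum (f := fun u => (N.adj u).length) (fun _ _ => Nat.zero_le _)
      (Finset.mem_univ N.source)
  omega

end PushState

/-! ### The upper bound for Yeh's algorithm -/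

section Upper

variable {n m : ℕ} {N : Network n m} {d : ℕ} {cuts : List (Finset (Fin m))}
  {enum : Finset (Fin m) → List (StateVec m)} {M : Memory m} {X : StateVec m} {b : ℕ}

/-- The set of all edges is a cut, so there is a minimal one. -/
theorem IsInput.cuts_ne_nil (h : IsInput N d cuts enum) : cuts ≠ [] := by
  have huniv : N.IsCut Finset.univ := by
    intro hreach
    rcases hreach.cases_head with h1 | ⟨_, ⟨a, ha, -⟩, -⟩
    · exact N.source_ne_sink h1
    · exact ha (Finset.mem_univ _)
  obtain ⟨K, -, hK⟩ := exists_minimal_le_of_wellFoundedLT N.IsCut _ huniv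
  exact List.ne_nil_of_mem ((h.mem_cuts K).2 hK)

/-- The preflow-push algorithm runs as a subroutine. -/
theorem HaltsWithin.maxFlow {s : PushState n m} {t : ℕ} (hs : HaltsIn (PushState.step N X) s t)
    (h : ∀ f value, HaltsWithin (yehStep N d cuts enum) (.step4 M X f value) b) :
    HaltsWithin (yehStep N d cuts enum) (.step3 M X s) (b + 1 + t) := by
  induction hs with
  | @halt s hs => exact (h s.flow (s.excess N.sink)).next (by simp [yehStep, hs])
  | next hs _ ih => exact ih.next (by simp [yehStep, hs])

/-- The graph search runs as a subroutine. -/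
theorem HaltsWithin.pathSearch {f : Fin m → ℤ} {e : Fin m} {es : List (Fin m)} {s : SearchState n m}
    {t : ℕ} (hs : HaltsIn (SearchState.step N (X.raise e) f) s t)
    (h2 : HaltsWithin (yehStep N d cuts enum) (.step2 M) b)
    (h7 : HaltsWithin (yehStep N d cuts enum) (.step7 M X f es) b) :
    HaltsWithin (yehStep N d cuts enum) (.step6 M X f e es s) (b + 1 + t) := by
  induction hs with
  | @halt s hs =>
    by_cases hf : s.found
    · exact h7.next (by simp [yehStep, hs, hf])
    · exact h2.next (by simp [yehStep, hs, hf])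
  | next hs _ ih => exact ih.next (by simp [yehStep, hs])

/-- Testing the edges `es` takes time `O(n + m)` for each of them. -/
theorem HaltsWithin.edgeTests (f : Fin m → ℤ) (es : List (Fin m))
    (h2 : ∀ out, HaltsWithin (yehStep N d cuts enum) (.step2 { M with output := out }) b) :
    HaltsWithin (yehStep N d cuts enum) (.step7 M X f es)
      (b + 1 + es.length * (3 * n + 2 * m + 4)) := by
  induction es with
  | nil =>
    refine ((h2 (X :: M.output)).next (c := .step7 M X f []) rfl).mono ?_
    rw [List.length_nil, Nat.zero_mul]
  | cons e es ih =>
    obtain ⟨t, ht, hs⟩ := SearchState.haltsWithin_start N (X.raise e) f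
    have h6 := HaltsWithin.pathSearch (X := X) hs ((h2 M.output).mono (by omega)) ih
    have h5 : HaltsWithin (yehStep N d cuts enum) (.step5 M X f e es)
        (b + 1 + es.length * (3 * n + 2 * m + 4) + 1 + t + 1) := by
      by_cases hX : X e = N.W e
      · exact (ih.next (by simp [yehStep, hX])).mono (by omega)
      · exact h6.next (by simp [yehStep, hX])
    refine (h5.next rfl).mono ?_
    rw [List.length_cons, Nat.add_mul]
    omega

/-- The time for one candidate `X`, if the preflow-push algorithm takes time `T`. -/
theorem HaltsWithin.candidate {T : ℕ}
    (hT : HaltsWithin (PushState.step N X) (PushState.start N) T)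
    (h2 : ∀ out, HaltsWithin (yehStep N d cuts enum) (.step2 { M with output := out }) b) :
    HaltsWithin (yehStep N d cuts enum) (.step3 M X (PushState.start N))
      (b + 3 + m * (3 * n + 2 * m + 4) + T) := by
  obtain ⟨t, ht, hs⟩ := hT
  refine (HaltsWithin.maxFlow (b := b + 2 + m * (3 * n + 2 * m + 4)) hs fun f value => ?_).mono
    (by omega)
  by_cases hv : value = d
  · have h7 := HaltsWithin.edgeTests (X := X) f (List.finRange m) h2
    rw [List.length_finRange] at h7
    cases hm : List.finRange m with
    | nil =>
      rw [hm] at h7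
      exact (h7.next (by simp [yehStep, hv, hm])).mono (by omega)
    | cons e es =>
      rw [hm] at h7
      -- step 5 for the first edge is what comes after a step 7
      obtain ⟨_, ht', h7⟩ := h7
      cases h7 with
      | halt h => simp [yehStep] at h
      | next h h5 =>
        simp only [yehStep, Option.some_inj] at h
        subst h
        exact ⟨_, by omega, .next (by simp [yehStep, hv, hm]) h5⟩
  · exact ((h2 M.output).next (by simp [yehStep, hv])).mono (by omega)

/-- The time from a request for a candidate to the end, when the cuts `Ks` and the candidates `sols`
of the current cut are still to be treated. -/
theorem HaltsWithin.candidates {σ T : ℕ} (hσ : ∀ K ∈ cuts, (enum K).length ≤ σ)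
    (hT : ∀ X, HaltsWithin (PushState.step N X) (PushState.start N) T)
    (Ks : List (Finset (Fin m))) (hKs : ∀ K ∈ Ks, K ∈ cuts) (sols : List (StateVec m))
    (out : List (StateVec m)) :
    HaltsWithin (yehStep N d cuts enum) (.step2 ⟨Ks, sols, out⟩)
      (2 + sols.length * (4 + m * (3 * n + 2 * m + 4) + T) +
        Ks.length * (σ * (4 + m * (3 * n + 2 * m + 4) + T) + 2)) := by
  induction Ks generalizing sols out with
  | nil =>
    induction sols generalizing out with
    | nil =>
      have h1 : HaltsWithin (yehStep N d cuts enum) (.halted out) 0 := .of_halt rfl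
      exact ((h1.next (c := .step8 ⟨[], [], out⟩) rfl).next rfl).mono (by omega)
    | cons X Xs ih =>
      refine ((HaltsWithin.candidate (M := ⟨[], Xs, out⟩) (hT X) ih).next rfl).mono ?_
      rw [List.length_cons, Nat.add_mul]
      omega
  | cons K Ks ihK =>
    have ihK := ihK fun K' hK' => hKs K' (List.mem_cons_of_mem _ hK')
    induction sols generalizing out with
    | nil =>
      refine (((ihK (enum K) out).next (c := .step8 ⟨K :: Ks, [], out⟩) rfl).next rfl).mono ?_
      have := Nat.mul_le_mul_right (4 + m * (3 * n + 2 * m + 4) + T)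
        (hσ K (hKs K List.mem_cons_self))
      rw [List.length_cons, Nat.add_mul Ks.length]
      omega
    | cons X Xs ih =>
      refine ((HaltsWithin.candidate (M := ⟨K :: Ks, Xs, out⟩) (hT X) ih).next rfl).mono ?_
      rw [List.length_cons (as := Xs), Nat.add_mul Xs.length]
      omega

theorem HaltsWithin.ofInput {σ T : ℕ} (hσ : ∀ K ∈ cuts, (enum K).length ≤ σ)
    (hT : ∀ X, HaltsWithin (PushState.step N X) (PushState.start N) T) (hcuts : cuts ≠ []) :
    HaltsWithin (yehStep N d cuts enum) .step1
      (cuts.length * (σ * (4 + m * (3 * n + 2 * m + 4) + T) + 3)) := by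
  cases hc : cuts with
  | nil => exact absurd hc hcuts
  | cons K Ks =>
    rw [← hc]
    have h2 := HaltsWithin.candidates (d := d) hσ hT Ks
      (fun K' hK' => hc ▸ List.mem_cons_of_mem _ hK') (enum K) []
    refine (h2.next (by simp [yehStep, hc])).mono ?_
    have := Nat.mul_le_mul_right (4 + m * (3 * n + 2 * m + 4) + T)
      (hσ K (hc ▸ List.mem_cons_self))
    have h3 : Ks.length * (σ * (4 + m * (3 * n + 2 * m + 4) + T) + 2) ≤
      Ks.length * (σ * (4 + m * (3 * n + 2 * m + 4) + T) + 3) := by gcongr; omega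
    rw [hc, List.length_cons, Nat.add_mul Ks.length]
    omega

/-- Yeh's algorithm takes time `O((m² + n² √m) p σ)`. -/
theorem IsInput.haltsIn {σ : ℕ} (h : IsInput N d cuts enum) (hm : 1 ≤ m) (hσ1 : 1 ≤ σ)
    (hσ : ∀ K ∈ cuts, (enum K).length ≤ σ) :
    ∃ t : ℕ, HaltsIn (yehStep N d cuts enum) .step1 t ∧
      (t : ℝ) ≤ 200 * (((m : ℝ) ^ 2 + (n : ℝ) ^ 2 * √(m : ℝ)) * (cuts.length : ℝ) * (σ : ℝ)) := by
  have hK : m ≤ (Nat.sqrt m + 1) ^ 2 := by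
    rw [pow_two]
    exact (Nat.lt_succ_sqrt m).le
  obtain ⟨t, ht, hrun⟩ := HaltsWithin.ofInput (d := d) hσ
    (fun X => PushState.haltsWithin_start (N := N) (X := X) (Nat.succ_pos _) hK) h.cuts_ne_nil
  refine ⟨t, hrun, ?_⟩
  have hn : (2 : ℝ) ≤ n := by exact_mod_cast N.two_le_nodes
  have hm' : (1 : ℝ) ≤ m := by exact_mod_cast hm
  have hσ' : (1 : ℝ) ≤ σ := by exact_mod_cast hσ1
  have hq : (1 : ℝ) ≤ √(m : ℝ) := Real.one_le_sqrt.2 hm'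
  have hKq : ((Nat.sqrt m + 1 : ℕ) : ℝ) ≤ 2 * √(m : ℝ) := by
    have := Real.nat_sqrt_le_real_sqrt (a := m)
    push_cast
    linarith
  set q := √(m : ℝ)
  have ht' : (t : ℝ) ≤ cuts.length * (σ * (4 + m * (3 * n + 2 * m + 4) +
      (24 * (n * m) + 52 * (n ^ 2 * (Nat.sqrt m + 1 : ℕ)) + 3 * m + 5 * n + 2)) + 3) := by
    exact_mod_cast ht
  have e1 : (n : ℝ) ^ 2 ≤ n ^ 2 * q := le_mul_of_one_le_right (by positivity) hq
  have e2 : (n : ℝ) * m ≤ m ^ 2 + n ^ 2 * q := by nlinarith [sq_nonneg ((n : ℝ) - m)]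
  have e3 : (m : ℝ) ≤ m ^ 2 := by nlinarith
  have e4 : (n : ℝ) ≤ n ^ 2 := by nlinarith
  have e5 : (n : ℝ) ^ 2 * (Nat.sqrt m + 1 : ℕ) ≤ 2 * (n ^ 2 * q) := by
    have := mul_le_mul_of_nonneg_left hKq (sq_nonneg (n : ℝ))
    linarith
  have e6 : (4 + m * (3 * n + 2 * m + 4) +
      (24 * (n * m) + 52 * (n ^ 2 * (Nat.sqrt m + 1 : ℕ)) + 3 * m + 5 * n + 2) + 3 : ℝ) ≤
      200 * (m ^ 2 + n ^ 2 * q) := by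
    nlinarith
  calc (t : ℝ) ≤ cuts.length * (σ * (4 + m * (3 * n + 2 * m + 4) +
      (24 * (n * m) + 52 * (n ^ 2 * (Nat.sqrt m + 1 : ℕ)) + 3 * m + 5 * n + 2)) + 3) := ht'
    _ ≤ cuts.length * (σ * (4 + m * (3 * n + 2 * m + 4) +
      (24 * (n * m) + 52 * (n ^ 2 * (Nat.sqrt m + 1 : ℕ)) + 3 * m + 5 * n + 2) + 3)) := by
        gcongr
        linarith
    _ ≤ cuts.length * (σ * (200 * (m ^ 2 + n ^ 2 * q))) := by gcongr
    _ = _ := by ring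

end Upper

/-! ### A family of networks on which the algorithm is slow -/

section Lower

variable {n m : ℕ}

/-- Every halting run that starts in the given configuration has at least `b` transitions. -/
def TakesAtLeast {α : Type*} (step : α → Option α) (c : α) (b : ℕ) : Prop :=
  ∀ t, HaltsIn step c t → b ≤ t

theorem TakesAtLeast.next {α : Type*} {step : α → Option α} {c c' : α} {b : ℕ}
    (h' : TakesAtLeast step c' b) (h : step c = some c') : TakesAtLeast step c (b + 1) := by
  intro t ht
  cases ht with
  | halt h0 => rw [h0] at h; cases h
  | next h1 ht =>
    rw [h1, Option.some_inj] at h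
    subst h
    exact Nat.succ_le_succ (h' _ ht)

theorem TakesAtLeast.mono {α : Type*} {step : α → Option α} {c : α} {b b' : ℕ}
    (h : TakesAtLeast step c b) (hb : b' ≤ b) : TakesAtLeast step c b' :=
  fun t ht => hb.trans (h t ht)

/-- The network of `m` parallel arcs of capacity one from the source to the sink. -/
def parallelNet (m : ℕ) : Network 2 m where
  fst _ := 0
  snd _ := 1
  undirected _ := false
  W _ := 1
  source := 0
  sink := 1
  source_ne_sink := by decide

/-- The states in which exactly one edge has capacity one, the other ones zero. -/
def unitStates (m : ℕ) : List (StateVec m) :=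
  (List.finRange m).map fun e => Pi.single e 1

theorem parallelNet_isCut {K : Finset (Fin m)} : (parallelNet m).IsCut K ↔ K = Finset.univ := by
  constructor
  · intro h
    by_contra hK
    obtain ⟨e, he⟩ : ∃ e, e ∉ K := by
      by_contra hcon
      push Not at hcon
      exact hK (Finset.eq_univ_iff_forall.2 hcon)
    exact h (.single ⟨(e, true), he, .inl rfl, rfl, rfl⟩)
  · rintro rfl hreach
    rcases hreach.cases_head with h1 | ⟨_, ⟨a, ha, -⟩, -⟩
    · exact (parallelNet m).source_ne_sink h1
    · exact ha (Finset.mem_univ _)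

theorem mem_unitStates {X : StateVec m} :
    X ∈ unitStates m ↔ (parallelNet m).IsFeasible 1 Finset.univ X := by
  simp only [unitStates, List.mem_map, List.mem_finRange, true_and]
  constructor
  · rintro ⟨e, rfl⟩
    refine ⟨by simp, fun e' _ => ?_, fun e' he' => absurd (Finset.mem_univ _) he'⟩
    simp only [parallelNet, Pi.single_apply]
    split_ifs <;> omega
  · rintro ⟨h1, -, -⟩
    obtain ⟨e, -, he⟩ : ∃ e ∈ Finset.univ, X e ≠ 0 :=
      Finset.exists_ne_zero_of_sum_ne_zero (by rw [h1]; exact one_ne_zero)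
    rw [← Finset.add_sum_erase _ _ (Finset.mem_univ e)] at h1
    have h2 : ∑ e' ∈ Finset.univ.erase e, X e' = 0 := by omega
    refine ⟨e, funext fun e' => ?_⟩
    by_cases hee : e' = e
    · subst hee
      rw [Pi.single_eq_same]
      omega
    · rw [Pi.single_eq_of_ne hee]
      exact (Finset.sum_eq_zero_iff.1 h2 e' (by simp [hee])).symm

theorem isInput_parallelNet (m : ℕ) :
    IsInput (parallelNet m) 1 [Finset.univ] fun _ => unitStates m where
  cuts_nodup := List.nodup_singleton _
  mem_cuts K := by
    rw [List.mem_singleton, Network.IsMinimalCut]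
    constructor
    · rintro rfl
      exact ⟨parallelNet_isCut.2 rfl, fun K' hK' _ => (parallelNet_isCut.1 hK').ge⟩
    · intro h
      exact parallelNet_isCut.1 h.prop
  enum_nodup _ _ := by
    refine (List.nodup_finRange m).map fun e e' h => ?_
    by_contra hne
    have := congrFun h e
    simp [Pi.single_eq_of_ne hne] at this
  mem_enum K hK X := by
    rw [List.mem_singleton.1 hK]
    exact mem_unitStates

theorem parallelNet_length_adj : m ≤ ((parallelNet m).adj (parallelNet m).source).length := by
  calc m = (Finset.univ.image fun e : Fin m => ((e, true) : Arc m)).card := by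
        rw [Finset.card_image_of_injective _ fun e e' h => (Prod.ext_iff.1 h).1]
        simp
    _ ≤ ((parallelNet m).adj (parallelNet m).source).toFinset.card := by
        refine Finset.card_le_card fun a ha => ?_
        obtain ⟨e, -, rfl⟩ := Finset.mem_image.1 ha
        exact List.mem_toFinset.2 ((parallelNet m).mem_adj.2 rfl)
    _ ≤ _ := List.toFinset_card_le _

theorem parallelNet_eq_true {a : Arc m} (h : (parallelNet m).tail a = (parallelNet m).source) :
    a = (a.1, true) := by
  obtain ⟨e, b⟩ := a
  cases b
  · simp [Network.tail, parallelNet] at h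
  · rfl

variable {cuts : List (Finset (Fin m))} {enum : Finset (Fin m) → List (StateVec m)}
  {M : Memory m} {X : StateVec m} {b : ℕ}

/-- After a maximum flow has been sent, every search succeeds, but only after all arcs out of the
source have been examined. -/
theorem TakesAtLeast.pathSearch {e : Fin m} {es : List (Fin m)}
    (h : TakesAtLeast (yehStep (parallelNet m) 1 cuts enum) (.step7 M X (fun e => X e) es) b)
    (as : List (Arc m)) (has : ∀ a ∈ as, (parallelNet m).tail a = (parallelNet m).source)
    (marked : Fin 2 → Bool) (pending : List (Fin 2))
    (hs : (pending = [1] ∧ marked 1 = true) ∨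
      (pending = [] ∧ marked 1 = false ∧ (e, true) ∈ as)) :
    TakesAtLeast (yehStep (parallelNet m) 1 cuts enum)
      (.step6 M X (fun e => X e) e es ⟨0, marked, pending, as, false⟩) (b + as.length) := by
  induction as generalizing marked pending with
  | nil =>
    rcases hs with ⟨rfl, -⟩ | ⟨-, -, h0⟩
    · have h1 : TakesAtLeast (yehStep (parallelNet m) 1 cuts enum)
          (.step6 M X (fun e => X e) e es ⟨0, marked, [1], [], true⟩) (b + 1) :=
        h.next (by simp [yehStep, SearchState.step])
      exact (h1.next (by simp [yehStep, SearchState.step, parallelNet])).mono (by simp; omega)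
    · simp at h0
  | cons a as ih =>
    have ih := ih fun a' ha' => has a' (List.mem_cons_of_mem _ ha')
    have ha := parallelNet_eq_true (has a List.mem_cons_self)
    have hhead : (parallelNet m).head a = 1 := by rw [ha]; rfl
    by_cases hc : 0 < (parallelNet m).residual (X.raise e) (fun e => X e) a ∧ marked 1 = false
    · rcases hs with ⟨-, h1⟩ | ⟨rfl, h1, h2⟩
      · rw [hc.2] at h1
        cases h1
      · refine ((ih (Function.update marked 1 true) [1] (.inl ⟨rfl, by simp⟩)).next ?_).mono
          (by rw [List.length_cons]; omega)
        simp [yehStep, SearchState.step, hhead, hc]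
    · refine ((ih marked pending ?_).next ?_).mono (by rw [List.length_cons]; omega)
      · refine hs.imp id fun ⟨h1, h2, h3⟩ => ⟨h1, h2, (List.mem_cons.1 h3).resolve_left ?_⟩
        rintro rfl
        refine hc ⟨?_, h2⟩
        simp [Network.residual, StateVec.raise]
      · simp only [yehStep, SearchState.step, hhead]
        rw [if_neg hc]

/-- Testing the edges `es` costs at least `m` for each of them that is below its capacity. -/
theorem TakesAtLeast.edgeTests (es : List (Fin m))
    (h : ∀ out, TakesAtLeast (yehStep (parallelNet m) 1 cuts enum)
      (.step2 { M with output := out }) b) :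
    TakesAtLeast (yehStep (parallelNet m) 1 cuts enum) (.step7 M X (fun e => X e) es)
      (b + 1 + (es.map fun e => if X e = 1 then 0 else m).sum) := by
  induction es with
  | nil =>
    refine ((h (X :: M.output)).next (c := .step7 M X _ []) rfl).mono ?_
    rw [List.map_nil, List.sum_nil, Nat.add_zero]
  | cons e es ih =>
    have h5 : TakesAtLeast (yehStep (parallelNet m) 1 cuts enum) (.step5 M X (fun e => X e) e es)
        (b + 1 + ((e :: es).map fun e => if X e = 1 then 0 else m).sum) := by
      by_cases hX : X e = 1
      · refine (ih.next (by simp [yehStep, parallelNet, hX])).mono ?_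
        simp [hX]
      · have h6 := TakesAtLeast.pathSearch (e := e) ih _
          (fun a ha => (parallelNet m).mem_adj.1 ha) (fun v => v = 0) [] (.inr ⟨rfl, by simp,
            (parallelNet m).mem_adj.2 rfl⟩)
        have h60 : TakesAtLeast (yehStep (parallelNet m) 1 cuts enum)
            (.step6 M X (fun e => X e) e es ⟨0, fun v => v = 0, [0], [], false⟩) _ :=
          h6.next (by simp [yehStep, SearchState.step, parallelNet])
        have h61 : TakesAtLeast (yehStep (parallelNet m) 1 cuts enum)
            (.step6 M X (fun e => X e) e es ⟨1, fun v => v = 0, [0], [], false⟩) _ :=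
          h60.next rfl
        have h62 : TakesAtLeast (yehStep (parallelNet m) 1 cuts enum)
            (.step6 M X (fun e => X e) e es ⟨2, fun v => v = 0, [0], [], false⟩) _ :=
          h61.next rfl
        refine (h62.next ?_).mono ?_
        · simp [yehStep, parallelNet, hX, SearchState.start]
          rfl
        · have := parallelNet_length_adj (m := m)
          simp only [List.map_cons, List.sum_cons, if_neg hX]
          omega
    exact (h5.next rfl).mono (Nat.le_succ _)

/-- There are no nodes besides the source and the sink, so the preflow-push algorithm is done once
the arcs out of the source are saturated. -/
theorem TakesAtLeast.maxFlow
    (h : TakesAtLeast (yehStep (parallelNet m) 1 cuts enum)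
      (.step4 M X (fun e => X e) (∑ e, (X e : ℤ))) b) :
    TakesAtLeast (yehStep (parallelNet m) 1 cuts enum)
      (.step3 M X (PushState.start (parallelNet m))) b := by
  have hmain : ∀ s, PushState.SatInv (parallelNet m) X s [] → s.stage = .main →
      TakesAtLeast (yehStep (parallelNet m) 1 cuts enum) (.step3 M X s) b := by
    intro s hs hst
    have hflow : s.flow = fun e => (X e : ℤ) := by
      funext e
      have h1 := hs.preflow.residual_nonneg (e, true)
      have h2 : ¬ 0 < (parallelNet m).residual X s.flow (e, true) := fun h2 => by
        simpa using hs.residual (e, true) rfl (by simp [Network.head, parallelNet]) h2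
      simp only [Network.residual, if_true] at h1 h2
      omega
    have hex : s.excess (parallelNet m).sink = ∑ e, (X e : ℤ) := by
      rw [hs.preflow.excess_eq, Network.netIn, hflow]
      simp [parallelNet]
    have hbucket : s.bucket 0 = [] := by
      refine List.eq_nil_iff_forall_not_mem.2 fun v hv => ?_
      obtain ⟨-, h1, h2⟩ := (hs.mem_bucket v).1 hv
      fin_cases v
      · exact h1 rfl
      · exact h2 rfl
    have h1 : TakesAtLeast (yehStep (parallelNet m) 1 cuts enum)
        (.step3 M X { s with stage := .done }) (b + 1) := by
      refine h.next ?_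
      simp [yehStep, PushState.step, hflow, hex]
    refine (h1.next ?_).mono (by omega)
    simp [yehStep, PushState.step, hst, PushState.mainStep, hbucket, hs.level]
  have hsat : ∀ (as : List (Arc m)) (s : PushState 2 m), PushState.SatInv (parallelNet m) X s as →
      s.stage = .saturate as →
      TakesAtLeast (yehStep (parallelNet m) 1 cuts enum) (.step3 M X s) b := by
    intro as
    induction as with
    | nil =>
      intro s hs hst
      exact ((hmain _ (hs.setStage .main) rfl).next
        (by simp [yehStep, PushState.step, hst])).mono (Nat.le_succ _)
    | cons a as ih =>
      intro s hs hst
      exact ((ih _ (hs.push.setStage (.saturate as)) rfl).next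
        (by simp [yehStep, PushState.step, hst])).mono (Nat.le_succ _)
  have halloc : ∀ (k : ℕ), TakesAtLeast (yehStep (parallelNet m) 1 cuts enum)
      (.step3 M X { PushState.start (parallelNet m) with stage := .alloc k }) b := by
    intro k
    induction k with
    | zero =>
      exact ((hsat _ _ (PushState.SatInv.start.setStage
        (.saturate ((parallelNet m).adj (parallelNet m).source))) rfl).next rfl).mono
          (Nat.le_succ _)
    | succ k ih => exact (ih.next rfl).mono (Nat.le_succ _)
  exact halloc _

/-- Each of the `m` candidates causes `m - 1` searches. -/
theorem TakesAtLeast.candidate (hX : X ∈ unitStates m)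
    (h : ∀ out, TakesAtLeast (yehStep (parallelNet m) 1 cuts enum)
      (.step2 { M with output := out }) b) :
    TakesAtLeast (yehStep (parallelNet m) 1 cuts enum)
      (.step3 M X (PushState.start (parallelNet m))) (b + (m - 1) * m) := by
  refine TakesAtLeast.maxFlow ?_
  obtain ⟨e₀, -, rfl⟩ := List.mem_map.1 hX
  set X : StateVec m := Pi.single e₀ 1 with hXdef
  have hval : ∑ e, (X e : ℤ) = 1 := by
    exact_mod_cast (mem_unitStates.1 hX).1
  have hsum : ((List.finRange m).map fun e => if X e = 1 then 0 else m).sum = (m - 1) * m := by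
    rw [← Fin.sum_univ_def, ← Finset.add_sum_erase _ _ (Finset.mem_univ e₀),
      Finset.sum_congr rfl (g := fun _ => m)]
    · simp [hXdef]
    · intro e he
      simp [hXdef, Pi.single_eq_of_ne (Finset.ne_of_mem_erase he)]
  have h7 := TakesAtLeast.edgeTests (X := X) (List.finRange m) h
  rw [hsum] at h7
  cases hm : List.finRange m with
  | nil =>
    have := List.mem_finRange e₀
    rw [hm] at this
    simp at this
  | cons e es =>
    have h4 : yehStep (parallelNet m) 1 cuts enum (.step4 M X (fun e => X e) (∑ e, (X e : ℤ))) =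
        some (.step5 M X (fun e => X e) e es) := by
      simp only [yehStep, hval, Nat.cast_one, if_true, hm]
    rw [hm] at h7
    -- step 5 for the first edge is what comes after a step 7
    intro t ht
    cases ht with
    | halt h0 => rw [h0] at h4; cases h4
    | next h0 ht =>
      rw [h0, Option.some_inj] at h4
      subst h4
      have := h7 _ (.next rfl ht)
      omega

theorem TakesAtLeast.candidates (sols : List (StateVec m)) (hs : ∀ X ∈ sols, X ∈ unitStates m)
    (out : List (StateVec m)) :
    TakesAtLeast (yehStep (parallelNet m) 1 cuts enum) (.step2 ⟨[], sols, out⟩)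
      (sols.length * ((m - 1) * m)) := by
  induction sols generalizing out with
  | nil => intro t _; simp
  | cons X Xs ih =>
    have ih := ih fun X' hX' => hs X' (List.mem_cons_of_mem _ hX')
    refine ((TakesAtLeast.candidate (M := ⟨[], Xs, out⟩) (hs X List.mem_cons_self) ih).next
      rfl).mono ?_
    rw [List.length_cons, Nat.add_mul]
    omega

/-- There are `m` candidates, for each of which `m - 1` searches examine `m` arcs. -/
theorem takesAtLeast_parallelNet (m : ℕ) :
    TakesAtLeast (yehStep (parallelNet m) 1 [Finset.univ] fun _ => unitStates m) .step1
      (m * ((m - 1) * m)) := by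
  refine ((TakesAtLeast.candidates (unitStates m) (fun _ h => h) []).next rfl).mono ?_
  simp [unitStates]

end Lower

end DMC

theorem theorem2 :
    (∃ C : ℝ, ∀ (n m : ℕ) (N : DMC.Network n m) (d : ℕ) (cuts : List (Finset (Fin m)))
        (enum : Finset (Fin m) → List (DMC.StateVec m)) (σ : ℕ),
      1 ≤ m → DMC.IsInput N d cuts enum → 1 ≤ σ → (∀ K ∈ cuts, (enum K).length ≤ σ) →
      ∃ t : ℕ, DMC.HaltsIn (DMC.yehStep N d cuts enum) DMC.Config.step1 t ∧
        (t : ℝ) ≤ C * (((m : ℝ) ^ 2 + (n : ℝ) ^ 2 * √(m : ℝ)) * (cuts.length : ℝ) * (σ : ℝ))) ∧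
    (∀ C : ℝ, ∃ (n m : ℕ) (N : DMC.Network n m) (d : ℕ) (cuts : List (Finset (Fin m)))
        (enum : Finset (Fin m) → List (DMC.StateVec m)) (σ : ℕ),
      1 ≤ m ∧ 1 ≤ d ∧ DMC.IsInput N d cuts enum ∧ 1 ≤ σ ∧ (∀ K ∈ cuts, (enum K).length ≤ σ) ∧
      ∃ t : ℕ, DMC.HaltsIn (DMC.yehStep N d cuts enum) DMC.Config.step1 t ∧
        C * ((m : ℝ) * (n : ℝ) * (cuts.length : ℝ) * (σ : ℝ)) < (t : ℝ)) := by
  refine ⟨⟨200, fun n m N d cuts enum σ hm h hσ1 hσ => h.haltsIn hm hσ1 hσ⟩, fun C => ?_⟩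
  obtain ⟨k, hk⟩ := exists_nat_gt (2 * C)
  have hlen : (DMC.unitStates (k + 1)).length = k + 1 := by simp [DMC.unitStates]
  have hin := DMC.isInput_parallelNet (k + 1)
  obtain ⟨t, ht, -⟩ := hin.haltsIn (σ := k + 1) (by omega) (by omega) fun _ _ => hlen.le
  refine ⟨2, k + 1, DMC.parallelNet (k + 1), 1, _, _, k + 1, by omega, le_rfl, hin, by omega,
    fun _ _ => hlen.le, t, ht, ?_⟩
  have h1 : ((k + 1) * (k * (k + 1)) : ℝ) ≤ t := by
    exact_mod_cast DMC.takesAtLeast_parallelNet (k + 1) t ht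
  refine lt_of_lt_of_le ?_ h1
  push_cast
  simp only [List.length_singleton, Nat.cast_one]
  have h2 : (0 : ℝ) < ((k : ℝ) + 1) * (k + 1) := by positivity
  nlinarith
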